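/- **Setting.** Let $\mathcal S(\mathbb R)$ be the real Schwartz space and let $ML$ be the class of entire functions $\varphi(z)=\sum_n\varphi_nz^n$ with $\varphi(0)=1$, $\varphi_1=\varphi'(0)>0$, such that $\varphi(z\overline w)$ is a positive definite kernel on $\mathbb C$ and $s\mapsto\varphi(-\|s\|^2/2)$ is a positive definite function on $\mathcal S(\mathbb R)$, where $\|s\|^2=\int s(x)^2dx$. For $\varphi\in ML$ let $P_\varphi$ be the probability measure on the cylindrical $\sigma$-algebra $\mathcal C$ of the space $\mathcal S'(\mathbb R)$ of real tempered distributions with $$\int_{\mathcal S'(\mathbb R)} e^{i\langle\omega,s\rangle}\,dP_\varphi(\omega)=\varphi\left(-\tfrac{\|s\|^2}{2}\right),\qquad s\in\mathcal S(\mathbb R).$$ Let $\zeta_1,\zeta_2,\dots$ be the normalized Hermite functions $\zeta_j(x)=\pi^{-1/4}((j-1)!)^{-1/2}e^{-x^2/2}h_{j-1}(\sqrt2\,x)$ ($h_n$ the monic Hermite polynomials for the weight $e^{-x^2/2}$). For a multi-index $\gamma=(\gamma_1,\gamma_2,\dots)$ of non-negative integers with finitely many non-zero entries let $Q^\gamma(\omega)=\prod_j\langle\omega,\zeta_j\rangle^{\gamma_j}$,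 let $Q_j(\omega)=\langle\omega,\zeta_j\rangle$, and let $(\widetilde Q^\gamma)_\gamma$ be the orthonormal family obtained from $(Q^\gamma)_\gamma$ by Gram–Schmidt in $\mathbf L^2(\mathcal S'(\mathbb R),\mathcal C,P_\varphi)$, where $Q^\delta$ comes before $Q^\gamma$ if $\delta_j<\gamma_j$ at the largest index $j$ at which $\delta$ and $\gamma$ differ (that is, $\widetilde Q^\gamma$ is the normalized component of $Q^\gamma$ orthogonal to the closed span of all earlier monomials). Let $a=(a_n)_{n\ge1}$ and $b=(b_n)_{n\ge0}$ be sequences of positive numbers with $a_na_m\le a_{n+m}$, $b_nb_m\le b_{n+m}$, $a_1>1$, and $\sum_na_n^{-d}<\infty$, $\sum_nb_n^{-d}<\infty$ for some integer $d>1$. For $p\in\mathbb N_0$ let $\mathcal H_p(a,b)$ be the Hilbert space of formal series $f=\sum_\alpha f_\alpha\widetilde Q^\alpha$, $f_\alpha\in\mathbb C$, with $$\|f\|_p^2=\sum_\alpha b_{|\alpha|}^{-p}\Big(\prod_ja_j^{\alpha_j}\Big)^{-p}|f_\alpha|^2<\infty,$$ and let $\mathcal A=\bigcup_p\mathcal H_p(a,b)$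 carry the locally convex inductive limit topology. An element $F\in\mathbf L^2(P_\varphi)$ is identified with the series $\sum_\gamma\langle F,\widetilde Q^\gamma\rangle\widetilde Q^\gamma\in\mathcal H_0(a,b)\subset\mathcal A$. The Wick product of two formal series is determined by $\widetilde Q^\gamma\lozenge\widetilde Q^\delta=\widetilde Q^{\gamma+\delta}$, i.e. $(f\lozenge g)_\gamma=\sum_{\alpha+\beta=\gamma}f_\alpha g_\beta$. Finally let $$N_\varphi(t)=\frac1{\sqrt{\varphi_1}}\sum_{j=1}^\infty\zeta_j(t)\,Q_j .$$ **Theorem (stochastic integral).** Let $\varphi\in ML$, let $a,b$ be as above, and let $f$ be a continuous function from $[0,1]$ into $\mathcal A$. Then the series defining $N_\varphi(t)$ converges unconditionally in $\mathcal A$ for every $t\in\mathbb R$, $f(t)\lozenge N_\varphi(t)\in\mathcal A$ for every $t\in[0,1]$, and the integral $$\int_0^1f(t)\lozenge N_\varphi(t)\,dt$$ converges in $\mathcal A$: there is a unique $I\in\mathcal A$ to which the Riemann sums $\sum_i(x_{i+1}-x_i)\,f(\xi_i)\lozenge N_\varphi(\xi_i)$ over tagged partitions of $[0,1]$ converge in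 $\mathcal A$ as the mesh tends to $0$. Moreover there is $p_0\ge1$ such that $f(t)\lozenge N_\varphi(t)\in\mathcal H_{p_0}(a,b)$ for all $t\in[0,1]$, $I\in\mathcal H_{p_0}(a,b)$, and these Riemann sums converge to $I$ in the norm of $\mathcal H_{p_0}(a,b)$. -/

import Mathlib

open MeasureTheory Filter Topology SchwartzMap
open scoped InnerProductSpace

namespace ChaosML

noncomputable section

/-! ### The class `ML` -/

/-- The square `∫ s(x)² dx` of the `L²(ℝ, dx)`-norm of a real Schwartz function. -/
def l2NormSq (s : 𝓢(ℝ, ℝ)) : ℝ := ∫ x : ℝ, s x ^ 2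

open scoped ComplexOrder in
/-- The class `ML`: entire functions `φ` with `φ(0) = 1`, `φ'(0) > 0`, such that `φ(z w̄)` is a
positive definite kernel on `ℂ` and `φ(-‖·‖²/2)` is a positive definite function on the real
Schwartz space.  (`0 < c` for a complex number `c` means that `c` is real and positive.) -/
structure IsML (φ : ℂ → ℂ) : Prop where
  entire : Differentiable ℂ φ
  map_zero : φ 0 = 1
  deriv_pos : 0 < deriv φ 0
  posDef_kernel : ∀ (n : ℕ) (z : Fin n → ℂ),
    (Matrix.of fun i j => φ (z i * (starRingEnd ℂ) (z j))).PosSemidef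
  posDef_schwartz : ∀ (n : ℕ) (s : Fin n → 𝓢(ℝ, ℝ)),
    (Matrix.of fun i j => φ (-((l2NormSq (s i - s j) : ℝ) : ℂ) / 2)).PosSemidef

/-- The first Taylor coefficient `φ₁ = φ'(0)` (a positive real number for `φ ∈ ML`). -/
def coeffOne (φ : ℂ → ℂ) : ℝ := (deriv φ 0).re

/-! ### Real tempered distributions with the cylindrical σ-algebra, and the measure `P_φ` -/

/-- The space `𝓢'(ℝ)` of real tempered distributions. -/
def TemperedDual : Type := 𝓢(ℝ, ℝ) →L[ℝ] ℝ

/-- The duality bracket `⟨ω, s⟩`. -/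
def TemperedDual.pair (ω : TemperedDual) (s : 𝓢(ℝ, ℝ)) : ℝ :=
  (show 𝓢(ℝ, ℝ) →L[ℝ] ℝ from ω) s

/-- The cylindrical σ-algebra: the smallest one making every `ω ↦ ⟨ω, s⟩` measurable. -/
instance : MeasurableSpace TemperedDual :=
  ⨆ s : 𝓢(ℝ, ℝ), MeasurableSpace.comap (fun ω : TemperedDual => ω.pair s) inferInstance

/-- `P` is the probability measure `P_φ`, i.e. the probability measure with characteristic
functional `s ↦ φ(-‖s‖²/2)`. -/
structure IsMLMeasure (φ : ℂ → ℂ) (P : Measure TemperedDual) : Prop where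
  isProbabilityMeasure : IsProbabilityMeasure P
  charFunctional : ∀ s : 𝓢(ℝ, ℝ),
    ∫ ω, Complex.exp (Complex.I * ((ω.pair s : ℝ) : ℂ)) ∂P
      = φ (-((l2NormSq s : ℝ) : ℂ) / 2)

/-! ### Hermite functions -/

lemma pow_mul_gaussian_le (k : ℕ) (x : ℝ) :
    |x| ^ k * Real.exp (-(x ^ 2 / 2)) ≤ k.factorial * Real.exp (1 / 2) := by
  have h1 : |x| ^ k ≤ k.factorial * Real.exp |x| := by
    have h := Real.pow_div_factorial_le_exp |x| (abs_nonneg x) k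
    have hk : (0 : ℝ) < k.factorial := by positivity
    rw [div_le_iff₀ hk] at h
    linarith
  calc |x| ^ k * Real.exp (-(x ^ 2 / 2))
      ≤ (k.factorial * Real.exp |x|) * Real.exp (-(x ^ 2 / 2)) := by gcongr
    _ = k.factorial * Real.exp (|x| + -(x ^ 2 / 2)) := by rw [Real.exp_add]; ring
    _ ≤ k.factorial * Real.exp (1 / 2) := by
        gcongr
        nlinarith [sq_nonneg (|x| - 1), sq_abs x]

lemma exists_bound_poly_gaussian (p : Polynomial ℝ) :
    ∃ C : ℝ, ∀ x : ℝ, |p.eval x| * Real.exp (-(x ^ 2 / 2)) ≤ C := by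
  refine ⟨∑ i ∈ p.support, |p.coeff i| * (i.factorial * Real.exp (1 / 2)), fun x => ?_⟩
  have h : |p.eval x| ≤ ∑ i ∈ p.support, |p.coeff i| * |x| ^ i := by
    rw [Polynomial.eval_eq_sum, Polynomial.sum]
    refine (Finset.abs_sum_le_sum_abs _ _).trans (le_of_eq ?_)
    simp [abs_mul, abs_pow]
  calc |p.eval x| * Real.exp (-(x ^ 2 / 2))
      ≤ (∑ i ∈ p.support, |p.coeff i| * |x| ^ i) * Real.exp (-(x ^ 2 / 2)) := by gcongr
    _ = ∑ i ∈ p.support, |p.coeff i| * (|x| ^ i * Real.exp (-(x ^ 2 / 2))) := by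
        rw [Finset.sum_mul]; simp [mul_assoc]
    _ ≤ _ := by
        refine Finset.sum_le_sum fun i _ => ?_
        exact mul_le_mul_of_nonneg_left (pow_mul_gaussian_le i x) (abs_nonneg _)

/-- The function `e^{-x²/2}` as a Schwartz function. -/
def gaussianSchwartz : 𝓢(ℝ, ℝ) where
  toFun x := Real.exp (-(x ^ 2 / 2))
  smooth' := by fun_prop
  decay' := by
    intro k n
    obtain ⟨C, hC⟩ := exists_bound_poly_gaussian
      (Polynomial.X ^ k * (Polynomial.hermite n).map (Int.castRingHom ℝ))
    refine ⟨C, fun x => ?_⟩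
    rw [norm_iteratedFDeriv_eq_norm_iteratedDeriv, iteratedDeriv_eq_iterate,
      Polynomial.deriv_gaussian_eq_hermite_mul_gaussian]
    refine le_of_eq_of_le ?_ (hC x)
    simp [abs_mul, Polynomial.aeval_def, Polynomial.eval_map, mul_assoc]

/-- The function `ζ_j(x) = π^{-1/4} ((j-1)!)^{-1/2} e^{-x²/2} h_{j-1}(√2 x)`, `j = 1, 2, …`, with
`h_n` the (probabilists') Hermite polynomials. -/
def hermiteFun (j : ℕ+) (x : ℝ) : ℝ :=
  Real.pi ^ (-(1 / 4) : ℝ) * (√((j.natPred).factorial : ℝ))⁻¹ * Real.exp (-(x ^ 2 / 2)) *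
    Polynomial.aeval (√2 * x) (Polynomial.hermite j.natPred)

lemma hasTemperateGrowth_poly (p : Polynomial ℝ) :
    Function.HasTemperateGrowth (fun x : ℝ => p.eval x) := by
  have : (fun x : ℝ => p.eval x) = fun x => ∑ i ∈ p.support, p.coeff i * x ^ i := by
    funext x
    rw [Polynomial.eval_eq_sum, Polynomial.sum]
  rw [this]
  refine Function.HasTemperateGrowth.sum fun i _ => ?_
  exact (Function.HasTemperateGrowth.const _).mul (Function.HasTemperateGrowth.id'.pow i)

lemma hermiteFun_eq_poly (j : ℕ+) : ∃ p : Polynomial ℝ,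
    ∀ x, hermiteFun j x = p.eval x * gaussianSchwartz x := by
  refine ⟨Polynomial.C (Real.pi ^ (-(1 / 4) : ℝ) * (√((j.natPred).factorial : ℝ))⁻¹) *
    ((Polynomial.hermite j.natPred).map (Int.castRingHom ℝ)).comp
      (Polynomial.C (√2) * Polynomial.X), fun x => ?_⟩
  have hg : gaussianSchwartz x = Real.exp (-(x ^ 2 / 2)) := rfl
  rw [hg, hermiteFun]
  simp only [Polynomial.eval_mul, Polynomial.eval_C, Polynomial.eval_comp, Polynomial.eval_X,
    Polynomial.eval_map, Polynomial.aeval_def]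
  simp only [algebraMap_int_eq]
  ring

/-- The Hermite function `ζ_j` as an element of the real Schwartz space. -/
def hermiteSchwartz (j : ℕ+) : 𝓢(ℝ, ℝ) where
  toFun := hermiteFun j
  smooth' := by
    obtain ⟨p, hp⟩ := hermiteFun_eq_poly j
    have h : hermiteFun j =
        ⇑(SchwartzMap.smulLeftCLM ℝ (fun x : ℝ => p.eval x) gaussianSchwartz) := by
      funext x
      rw [SchwartzMap.smulLeftCLM_apply_apply (hasTemperateGrowth_poly p), hp, smul_eq_mul]
    rw [h]
    exact SchwartzMap.smooth _ _
  decay' := by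
    obtain ⟨p, hp⟩ := hermiteFun_eq_poly j
    have h : hermiteFun j =
        ⇑(SchwartzMap.smulLeftCLM ℝ (fun x : ℝ => p.eval x) gaussianSchwartz) := by
      funext x
      rw [SchwartzMap.smulLeftCLM_apply_apply (hasTemperateGrowth_poly p), hp, smul_eq_mul]
    rw [h]
    exact (SchwartzMap.smulLeftCLM ℝ (fun x : ℝ => p.eval x) gaussianSchwartz).decay'

/-! ### The orthonormal polynomials `Q̃^γ` in `L²(𝓢'(ℝ), P)` -/

/-- Multi-indices `(α₁, α₂, …)` with finitely many nonzero entries. -/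
abbrev MultiIndex : Type := ℕ+ →₀ ℕ

/-- The monomial `Q^γ(ω) = ∏_j ⟨ω, ζ_j⟩^{γ_j}`. -/
def monomialFun (γ : MultiIndex) (ω : TemperedDual) : ℂ :=
  γ.prod fun j k => ((ω.pair (hermiteSchwartz j) : ℝ) : ℂ) ^ k

open Classical in
/-- The class of `Q^γ` in `L²(P)`.  (For `P = P_φ` all moments exist, so that the first branch
always applies.) -/
def monomialLp (P : Measure TemperedDual) (γ : MultiIndex) : Lp ℂ 2 P :=
  if h : MemLp (monomialFun γ) 2 P then h.toLp (monomialFun γ) else 0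

/-- The order in which the monomials are orthogonalised: `δ` comes before `γ` if `δ_j < γ_j` at the
largest index `j` where they differ.  So all monomials in the first `N` variables come before those
in which the variable of index `N + 1` occurs. -/
def Before (δ γ : MultiIndex) : Prop := ∃ j, δ j < γ j ∧ ∀ i, j < i → δ i = γ i

lemma Before.trans {α β γ : MultiIndex} (h₁ : Before α β) (h₂ : Before β γ) : Before α γ := by
  obtain ⟨j, hj, hj'⟩ := h₁
  obtain ⟨k, hk, hk'⟩ := h₂
  rcases lt_trichotomy j k with h | h | h
  · exact ⟨k, by rw [hj' k h]; exact hk, fun i hi => by rw [hj' i (h.trans hi), hk' i hi]⟩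
  · subst h
    exact ⟨j, hj.trans hk, fun i hi => by rw [hj' i hi, hk' i hi]⟩
  · exact ⟨j, by rw [← hk' j h]; exact hj, fun i hi => by rw [hj' i hi, hk' i (h.trans hi)]⟩

lemma before_or_before {α β : MultiIndex} (h : α ≠ β) : Before α β ∨ Before β α := by
  classical
  set s : Finset ℕ+ := (α.support ∪ β.support).filter fun i => α i ≠ β i with hs
  have hmem : ∀ i, α i ≠ β i → i ∈ s := by
    intro i hi
    rw [hs, Finset.mem_filter]
    refine ⟨?_, hi⟩
    rw [Finset.mem_union, Finsupp.mem_support_iff, Finsupp.mem_support_iff]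
    by_contra! hc
    exact hi (hc.1.trans hc.2.symm)
  have hne : s.Nonempty := by
    obtain ⟨i, hi⟩ := DFunLike.ne_iff.mp h
    exact ⟨i, hmem i hi⟩
  have hmax : α (s.max' hne) ≠ β (s.max' hne) := (Finset.mem_filter.mp (s.max'_mem hne)).2
  have heq : ∀ i, s.max' hne < i → α i = β i := by
    intro i hi
    by_contra hc
    exact absurd (s.le_max' i (hmem i hc)) (not_le.mpr hi)
  rcases lt_or_gt_of_ne hmax with hlt | hlt
  · exact Or.inl ⟨_, hlt, heq⟩
  · exact Or.inr ⟨_, hlt, fun i hi => (heq i hi).symm⟩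

/-- The closed linear span in `L²(P)` of the monomials that come before `Q^γ`. -/
def prevSpan (P : Measure TemperedDual) (γ : MultiIndex) : Submodule ℂ (Lp ℂ 2 P) :=
  (Submodule.span ℂ {F | ∃ δ, Before δ γ ∧ F = monomialLp P δ}).topologicalClosure

instance (P : Measure TemperedDual) (γ : MultiIndex) : CompleteSpace (prevSpan P γ) :=
  (Submodule.isClosed_topologicalClosure _).completeSpace_coe

/-- The component of `Q^γ` orthogonal to all monomials that come before it. -/
def residual (P : Measure TemperedDual) (γ : MultiIndex) : Lp ℂ 2 P :=
  monomialLp P γ - (prevSpan P γ).starProjection (monomialLp P γ)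

/-- The Gram–Schmidt orthonormalisation `Q̃^γ` of the monomials `Q^γ`. -/
def chaosBasis (P : Measure TemperedDual) (γ : MultiIndex) : Lp ℂ 2 P :=
  ((‖residual P γ‖⁻¹ : ℝ) : ℂ) • residual P γ

lemma prevSpan_mono (P : Measure TemperedDual) {δ γ : MultiIndex} (h : Before δ γ) :
    prevSpan P δ ≤ prevSpan P γ := by
  refine Submodule.topologicalClosure_mono (Submodule.span_mono ?_)
  rintro F ⟨ε, hε, rfl⟩
  exact ⟨ε, hε.trans h, rfl⟩

lemma chaosBasis_mem (P : Measure TemperedDual) {δ γ : MultiIndex} (h : Before δ γ) :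
    chaosBasis P δ ∈ prevSpan P γ := by
  refine Submodule.smul_mem _ _ (Submodule.sub_mem _ ?_ ?_)
  · exact Submodule.le_topologicalClosure _ (Submodule.subset_span ⟨δ, h, rfl⟩)
  · exact prevSpan_mono P h (Submodule.starProjection_apply_mem _ _)

lemma chaosBasis_orthogonal (P : Measure TemperedDual) {δ γ : MultiIndex} (h : δ ≠ γ) :
    ⟪chaosBasis P δ, chaosBasis P γ⟫_ℂ = 0 := by
  have key : ∀ {δ γ : MultiIndex}, Before δ γ → ⟪chaosBasis P δ, chaosBasis P γ⟫_ℂ = 0 := by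
    intro δ γ hb
    have hr : residual P γ ∈ (prevSpan P γ)ᗮ := Submodule.sub_starProjection_mem_orthogonal _
    exact Submodule.inner_right_of_mem_orthogonal (chaosBasis_mem P hb)
      (Submodule.smul_mem _ _ hr)
  rcases before_or_before h with hb | hb
  · exact key hb
  · exact inner_eq_zero_symm.mp (key hb)

lemma norm_chaosBasis (P : Measure TemperedDual) {γ : MultiIndex} (h : chaosBasis P γ ≠ 0) :
    ‖chaosBasis P γ‖ = 1 := by
  have hr : residual P γ ≠ 0 := by
    intro h0
    exact h (by rw [chaosBasis, h0, smul_zero])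
  rw [chaosBasis, norm_smul, Complex.norm_real, norm_inv, norm_norm,
    inv_mul_cancel₀ (norm_ne_zero_iff.mpr hr)]

/-- Bessel's inequality for the family `Q̃^γ`. -/
lemma summable_chaosCoeff (P : Measure TemperedDual) (F : Lp ℂ 2 P) :
    Summable fun γ : MultiIndex => ‖⟪chaosBasis P γ, F⟫_ℂ‖ ^ 2 := by
  have ho : Orthonormal ℂ fun γ : {γ : MultiIndex // chaosBasis P γ ≠ 0} => chaosBasis P γ :=
    ⟨fun γ => norm_chaosBasis P γ.2,
      fun γ δ h => chaosBasis_orthogonal P fun hc => h (Subtype.ext hc)⟩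
  have hs := ho.inner_products_summable (x := F)
  refine (Function.Injective.summable_iff Subtype.val_injective ?_).mp hs
  intro γ hγ
  have h0 : chaosBasis P γ = 0 := by
    by_contra hc
    exact hγ ⟨⟨γ, hc⟩, rfl⟩
  simp [h0]

/-! ### The spaces `𝓗_p(a, b)` and their inductive limit -/

/-- A pair of weight sequences `a = (a_n)_{n ≥ 1}`, `b = (b_n)_{n ≥ 0}` of positive numbers with
`a_n a_m ≤ a_{n+m}`, `b_n b_m ≤ b_{n+m}`, `a_1 > 1`, and `∑ a_n^{-d} < ∞`, `∑ b_n^{-d} < ∞` for some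
integer `d > 1`. -/
structure WeightPair where
  a : ℕ+ → ℝ
  b : ℕ → ℝ
  a_pos : ∀ n, 0 < a n
  b_pos : ∀ n, 0 < b n
  a_mul_le : ∀ n m, a n * a m ≤ a (n + m)
  b_mul_le : ∀ n m, b n * b m ≤ b (n + m)
  one_lt_a_one : 1 < a 1
  exists_summable : ∃ d : ℕ, 1 < d ∧ Summable (fun n => (a n ^ d)⁻¹) ∧
    Summable (fun n => (b n ^ d)⁻¹)

/-- The weight `d_{n,α} = b_n a^α` with `n = |α|` and `a^α = ∏_j a_j^{α_j}`. -/
def WeightPair.weight (W : WeightPair) (α : MultiIndex) : ℝ :=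
  W.b α.degree * α.prod fun j k => W.a j ^ k

lemma WeightPair.weight_pos (W : WeightPair) (α : MultiIndex) : 0 < W.weight α :=
  mul_pos (W.b_pos _) (Finset.prod_pos fun _ _ => pow_pos (W.a_pos _) _)

lemma WeightPair.one_le_a (W : WeightPair) (n : ℕ+) : 1 ≤ W.a n := by
  induction n using PNat.recOn with
  | one => exact W.one_lt_a_one.le
  | succ n ih =>
    refine le_trans ?_ (W.a_mul_le n 1)
    nlinarith [W.one_lt_a_one]

lemma WeightPair.exists_inv_weight_le (W : WeightPair) :
    ∃ C : ℝ, 0 ≤ C ∧ ∀ α, (W.weight α)⁻¹ ≤ C := by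
  obtain ⟨d, hd, -, hb⟩ := W.exists_summable
  refine ⟨1 + ∑' n, (W.b n ^ d)⁻¹, ?_, fun α => ?_⟩
  · have : 0 ≤ ∑' n, (W.b n ^ d)⁻¹ := tsum_nonneg fun n => by have := W.b_pos n; positivity
    linarith
  have hbn := W.b_pos α.degree
  have h1 : (W.b α.degree ^ d)⁻¹ ≤ ∑' n, (W.b n ^ d)⁻¹ :=
    hb.le_tsum α.degree fun n _ => by have := W.b_pos n; positivity
  have h2 : (W.b α.degree)⁻¹ ≤ 1 + (W.b α.degree ^ d)⁻¹ := by
    rcases le_total (W.b α.degree)⁻¹ 1 with h | h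
    · have : 0 ≤ (W.b α.degree ^ d)⁻¹ := by positivity
      linarith
    · have : (W.b α.degree)⁻¹ ≤ (W.b α.degree)⁻¹ ^ d := le_self_pow₀ h (by omega)
      rw [inv_pow] at this
      linarith
  have h3 : (W.weight α)⁻¹ ≤ (W.b α.degree)⁻¹ := by
    apply inv_anti₀ hbn
    rw [WeightPair.weight]
    refine le_mul_of_one_le_right hbn.le ?_
    exact Finset.prod_induction _ (fun x : ℝ => 1 ≤ x) (fun x y hx hy => one_le_mul_of_one_le_of_one_le hx hy)
      le_rfl fun j _ => one_le_pow₀ (W.one_le_a j)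
  linarith

variable (W : WeightPair)

/-- The factor `(b_{|α|} a^α)^{-p/2}`. -/
def WeightPair.scale (p : ℕ) (α : MultiIndex) : ℝ := (√(W.weight α ^ p))⁻¹

lemma WeightPair.scale_pos (p : ℕ) (α : MultiIndex) : 0 < W.scale p α :=
  inv_pos.mpr (Real.sqrt_pos.mpr (pow_pos (W.weight_pos α) p))

lemma WeightPair.norm_scale_smul_sq (p : ℕ) (α : MultiIndex) (c : ℂ) :
    ‖(W.scale p α : ℂ) * c‖ ^ 2 = (W.weight α ^ p)⁻¹ * ‖c‖ ^ 2 := by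
  rw [norm_mul, mul_pow, Complex.norm_real, Real.norm_of_nonneg (W.scale_pos p α).le,
    WeightPair.scale, inv_pow, Real.sq_sqrt (pow_pos (W.weight_pos α) p).le]

/-- Formal power series `∑_α f_α z^α` in countably many variables.  The formal variable `z^α`
stands for `Q̃^α`, so that the Wick product `Q̃^γ ◊ Q̃^δ = Q̃^{γ+δ}` is the product of formal power
series (the convolution of the coefficients). -/
abbrev Series : Type := MvPowerSeries ℕ+ ℂ

lemma memlp_iff (p : ℕ) (f : Series) :
    Memℓp (fun α : MultiIndex => (W.scale p α : ℂ) * MvPowerSeries.coeff α f) 2 ↔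
      Summable fun α : MultiIndex => (W.weight α ^ p)⁻¹ * ‖MvPowerSeries.coeff α f‖ ^ 2 := by
  rw [memℓp_gen_iff (by norm_num)]
  refine summable_congr fun α => ?_
  rw [← W.norm_scale_smul_sq]
  norm_num

/-- The series `f` with `∑_n b_n^{-p} ∑_{|α| = n} |f_α|² a^{-pα} < ∞`. -/
def hpSubmodule (p : ℕ) : Submodule ℂ Series where
  carrier := {f | Summable fun α : MultiIndex =>
    (W.weight α ^ p)⁻¹ * ‖MvPowerSeries.coeff α f‖ ^ 2}
  zero_mem' := by simp
  add_mem' := by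
    intro f g hf hg
    rw [Set.mem_ofPred_eq, ← memlp_iff] at hf hg ⊢
    convert hf.add hg using 1
    funext α
    simp [mul_add]
  smul_mem' := by
    intro c f hf
    rw [Set.mem_ofPred_eq, ← memlp_iff] at hf ⊢
    convert hf.const_smul c using 1
    funext α
    simp [mul_left_comm]

/-- The Hilbert space `𝓗_p(a, b)`. -/
def Hp (p : ℕ) : Type := hpSubmodule W p

instance (p : ℕ) : AddCommGroup (Hp W p) := inferInstanceAs (AddCommGroup (hpSubmodule W p))
instance (p : ℕ) : Module ℂ (Hp W p) := inferInstanceAs (Module ℂ (hpSubmodule W p))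

/-- The underlying formal power series of an element of `𝓗_p(a, b)`. -/
def Hp.series {p : ℕ} : Hp W p →ₗ[ℂ] Series := (hpSubmodule W p).subtype

/-- The map `f ↦ ((b_{|α|} a^α)^{-p/2} f_α)_α` from `𝓗_p(a, b)` to `ℓ²`. -/
def Hp.toL2 (p : ℕ) : Hp W p →ₗ[ℂ] lp (fun _ : MultiIndex => ℂ) 2 where
  toFun f := ⟨fun α => (W.scale p α : ℂ) * MvPowerSeries.coeff α (Hp.series W f),
    (memlp_iff W p _).mpr f.2⟩
  map_add' f g := by
    ext α
    change (W.scale p α : ℂ) * _ = (W.scale p α : ℂ) * _ + (W.scale p α : ℂ) * _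
    simp [mul_add]
  map_smul' c f := by
    ext α
    simp [mul_left_comm]

lemma Hp.toL2_injective (p : ℕ) : Function.Injective (Hp.toL2 W p) := by
  intro f g h
  apply Subtype.ext
  apply MvPowerSeries.ext
  intro α
  have h' := congrArg (fun x : lp (fun _ : MultiIndex => ℂ) 2 => x α) h
  exact mul_left_cancel₀ (Complex.ofReal_ne_zero.mpr (W.scale_pos p α).ne') h'

/-- The norm of `𝓗_p(a, b)`, transported from `ℓ²`; see `Hp.norm_sq`. -/
instance (p : ℕ) : NormedAddCommGroup (Hp W p) :=
  NormedAddCommGroup.induced (Hp W p) (lp (fun _ : MultiIndex => ℂ) 2) (Hp.toL2 W p)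
    (Hp.toL2_injective W p)

instance (p : ℕ) : NormedSpace ℂ (Hp W p) := NormedSpace.induced ℂ (Hp W p) _ (Hp.toL2 W p)

/-- `‖f‖_p² = ∑_α b_{|α|}^{-p} a^{-pα} |f_α|²`. -/
lemma Hp.norm_sq {p : ℕ} (f : Hp W p) :
    ‖f‖ ^ 2 = ∑' α : MultiIndex,
      (W.weight α ^ p)⁻¹ * ‖MvPowerSeries.coeff α (Hp.series W f)‖ ^ 2 := by
  have h1 : ‖f‖ = ‖Hp.toL2 W p f‖ := rfl
  have h2 := lp.norm_rpow_eq_tsum (p := 2) (by norm_num) (Hp.toL2 W p f)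
  rw [h1]
  norm_num at h2
  rw [h2]
  exact tsum_congr fun α => W.norm_scale_smul_sq p α _

lemma hpSubmodule_le_succ (p : ℕ) : hpSubmodule W p ≤ hpSubmodule W (p + 1) := by
  intro f hf
  obtain ⟨C, hC, h⟩ := W.exists_inv_weight_le
  refine Summable.of_nonneg_of_le (fun α => ?_) (fun α => ?_) (Summable.mul_left C hf)
  · have := W.weight_pos α
    positivity
  · have := W.weight_pos α
    rw [pow_succ, mul_inv, mul_comm _ (W.weight α)⁻¹, mul_assoc]
    exact mul_le_mul_of_nonneg_right (h α) (by positivity)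

lemma hpSubmodule_mono : Monotone (hpSubmodule W) :=
  monotone_nat_of_le_succ (hpSubmodule_le_succ W)

/-- The union `⋃_p 𝓗_p(a, b)`. -/
def algSubmodule : Submodule ℂ Series where
  carrier := {f | ∃ p, f ∈ hpSubmodule W p}
  zero_mem' := ⟨0, zero_mem _⟩
  add_mem' := by
    rintro f g ⟨p, hp⟩ ⟨q, hq⟩
    exact ⟨max p q, add_mem (hpSubmodule_mono W (le_max_left p q) hp)
      (hpSubmodule_mono W (le_max_right p q) hq)⟩
  smul_mem' := by
    rintro c f ⟨p, hp⟩
    exact ⟨p, Submodule.smul_mem _ c hp⟩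

/-- The space `𝓐 = ⋃_p 𝓗_p(a, b)`, the underlying space of the strong algebra. -/
def StrongAlg : Type := algSubmodule W

instance : AddCommGroup (StrongAlg W) := inferInstanceAs (AddCommGroup (algSubmodule W))
instance : Module ℂ (StrongAlg W) := inferInstanceAs (Module ℂ (algSubmodule W))

/-- The underlying formal power series of an element of `𝓐`. -/
def StrongAlg.series : StrongAlg W →ₗ[ℂ] Series := (algSubmodule W).subtype

/-- The inclusion `𝓗_p(a, b) ⊆ 𝓐`. -/
def incl (p : ℕ) : Hp W p →ₗ[ℂ] StrongAlg W :=
  Submodule.inclusion (p := hpSubmodule W p) (p' := algSubmodule W) fun _ hf => ⟨p, hf⟩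

/-- The inductive limit topology of `𝓐`: the finest locally convex vector space topology for which
all inclusions `𝓗_p(a, b) → 𝓐` are continuous.  (In Mathlib's order, finer topologies are
smaller.) -/
instance : TopologicalSpace (StrongAlg W) :=
  sInf {τ : TopologicalSpace (StrongAlg W) |
    @IsTopologicalAddGroup (StrongAlg W) τ _ ∧
    @ContinuousSMul ℂ (StrongAlg W) _ _ τ ∧
    @LocallyConvexSpace ℝ (StrongAlg W) _ _ _ _ τ ∧
    ∀ p, @Continuous (Hp W p) (StrongAlg W) _ τ (incl W p)}

/-- The Wick product of two elements of `𝓐`, as a formal power series. -/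
def wick (f g : StrongAlg W) : Series := StrongAlg.series W f * StrongAlg.series W g

/-! ### The embedding `L²(P) ⊆ 𝓐` and the process `N_φ` -/

/-- The embedding `L²(P) → 𝓐`, `F = ∑_γ c_γ Q̃^γ ↦ ∑_γ c_γ z^γ` with `c_γ = ⟨F, Q̃^γ⟩`. -/
def chaosEmbed (P : Measure TemperedDual) (F : Lp ℂ 2 P) : StrongAlg W :=
  ⟨fun γ => ⟪chaosBasis P γ, F⟫_ℂ, 0, by
    refine Summable.congr (summable_chaosCoeff P F) fun γ => ?_
    rw [pow_zero, inv_one, one_mul]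
    rfl⟩

/-- The element `Q_j = ⟨·, ζ_j⟩` of `𝓐`. -/
def coordElem (P : Measure TemperedDual) (j : ℕ+) : StrongAlg W :=
  chaosEmbed W P (monomialLp P (Finsupp.single j 1))

/-- The process `N_φ(t) = φ₁^{-1/2} ∑_{j ≥ 1} ζ_j(t) Q_j`, the sum being taken in `𝓐`. -/
def noise (φ : ℂ → ℂ) (P : Measure TemperedDual) (t : ℝ) : StrongAlg W :=
  (((√(coeffOne φ))⁻¹ : ℝ) : ℂ) • ∑' j : ℕ+, ((hermiteFun j t : ℝ) : ℂ) • coordElem W P j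

/-! ### Riemann integrals -/

/-- The function `g` on `[u, v]` has Riemann integral `I`: the Riemann sums
`∑_i (x_{i+1} - x_i) g(ξ_i)` over all tagged partitions `u = x_0 ≤ … ≤ x_n = v`,
`x_i ≤ ξ_i ≤ x_{i+1}`, converge to `I` as the mesh tends to `0`. -/
def HasRiemannIntegral {E : Type*} [AddCommGroup E] [Module ℝ E] [TopologicalSpace E]
    (g : ℝ → E) (u v : ℝ) (I : E) : Prop :=
  ∀ U ∈ 𝓝 I, ∃ δ : ℝ, 0 < δ ∧
    ∀ (n : ℕ) (x : Fin (n + 1) → ℝ) (ξ : Fin n → ℝ), Monotone x → x 0 = u → x (Fin.last n) = v →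
      (∀ i : Fin n, ξ i ∈ Set.Icc (x i.castSucc) (x i.succ)) →
      (∀ i : Fin n, x i.succ - x i.castSucc < δ) →
      ∑ i : Fin n, (x i.succ - x i.castSucc) • g (ξ i) ∈ U

end

end ChaosML

namespace ChaosML

noncomputable section

/-! ### The inductive limit topology -/

variable (W : WeightPair)

/-! Everything reduces to coefficient bounds of the form `‖f_α‖ ≤ C * W.weight α ^ k`. A family of
series with continuous coefficients satisfying such a bound uniformly in `t` is a continuous map
into a single Hilbert space `𝓗_p`: since `∑_α W.weight α ^ (-r)` converges for some `r`
(`exists_summable_weight`), the monomial expansion converges uniformly (`exists_continuousOn_hp`).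
The Riemann integral then exists in that Banach space and is carried to `𝓐` by the continuous
inclusion; it is unique because `𝓐` is Hausdorff.

The bound for `f(t) ◊ N_φ(t)` has three sources. The set `f([0,1])` is compact in the inductive
limit, hence bounded coefficientwise by one power of the weight
(`exists_norm_coeff_le_of_isCompact`). The noise is a series in the monomials of degree one only:
the law of the pairings depends only on Gram matrices, so it is invariant under `Q_j ↦ -Q_j`, and
Gram–Schmidt merely rescales `Q_j` (`coeff_coordElem_of_ne`). The coefficients of the `Q_j` are
bounded uniformly in `j`, while `|ζ_j(t)|` grows at most geometrically in `j`, which a power of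
`a_j` absorbs. Finally, a Wick product preserves such bounds, because the weight is
supermultiplicative and `γ` has at most polynomially many (in its weight) decompositions `α + β`
(`exists_norm_coeff_mul_le`). -/

instance : IsTopologicalAddGroup (StrongAlg W) := topologicalAddGroup_sInf fun _ h => h.1

instance : ContinuousSMul ℂ (StrongAlg W) := continuousSMul_sInf fun _ h => h.2.1

lemma continuous_incl (p : ℕ) : Continuous (incl W p) :=
  continuous_sInf_rng.mpr fun _ h => h.2.2.2 p

/-- A linear map from `𝓐` to a normed space is continuous if it is so on every `𝓗_p(a, b)`. -/
lemma continuous_of_comp_incl {F : Type*} [NormedAddCommGroup F] [NormedSpace ℂ F]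
    (T : StrongAlg W →ₗ[ℂ] F) (hT : ∀ p, Continuous fun f : Hp W p => T (incl W p f)) :
    Continuous T := by
  rw [continuous_iff_le_induced]
  -- The topology pulled back along `T` is one of those over which the infimum is taken.
  refine sInf_le ⟨topologicalAddGroup_induced T, ContinuousSMul.induced T, ?_, fun p => ?_⟩
  · exact LocallyConvexSpace.induced (T.restrictScalars ℝ)
  · exact continuous_induced_rng.mpr (hT p)

@[simp] lemma series_incl {p : ℕ} (f : Hp W p) :
    StrongAlg.series W (incl W p f) = Hp.series W f := rfl

lemma StrongAlg.series_injective : Function.Injective (StrongAlg.series W) :=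
  Subtype.val_injective

lemma WeightPair.scale_mul_norm_coeff_le {p : ℕ} (f : Hp W p) (α : MultiIndex) :
    W.scale p α * ‖MvPowerSeries.coeff α (Hp.series W f)‖ ≤ ‖f‖ := by
  have h := lp.norm_apply_le_norm (p := 2) (by norm_num) (Hp.toL2 W p f) α
  have h1 : ‖Hp.toL2 W p f‖ = ‖f‖ := rfl
  rw [h1] at h
  refine le_trans (le_of_eq ?_) h
  change _ = ‖(W.scale p α : ℂ) * _‖
  rw [norm_mul, Complex.norm_real, Real.norm_of_nonneg (W.scale_pos p α).le]

/-- A coefficient functional on `𝓗_p(a, b)`. -/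
def Hp.coeffCLM (p : ℕ) (α : MultiIndex) : Hp W p →L[ℂ] ℂ :=
  LinearMap.mkContinuous ((MvPowerSeries.coeff α).comp (Hp.series W)) (W.scale p α)⁻¹ fun f => by
    rw [inv_mul_eq_div, le_div_iff₀ (W.scale_pos p α), mul_comm]
    exact W.scale_mul_norm_coeff_le f α

@[simp] lemma Hp.coeffCLM_apply (p : ℕ) (α : MultiIndex) (f : Hp W p) :
    Hp.coeffCLM W p α f = MvPowerSeries.coeff α (Hp.series W f) := rfl

/-- A coefficient functional on `𝓐`. -/
def StrongAlg.coeffCLM (α : MultiIndex) : StrongAlg W →L[ℂ] ℂ where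
  toLinearMap := (MvPowerSeries.coeff α).comp (StrongAlg.series W)
  cont := continuous_of_comp_incl W _ fun p => (Hp.coeffCLM W p α).continuous

@[simp] lemma StrongAlg.coeffCLM_apply (α : MultiIndex) (f : StrongAlg W) :
    StrongAlg.coeffCLM W α f = MvPowerSeries.coeff α (StrongAlg.series W f) := rfl

/-- The continuous coefficient functionals separate points. Uniqueness of the integral rests on
this. -/
instance : T2Space (StrongAlg W) := by
  refine T2Space.of_injective_continuous (Y := MultiIndex → ℂ)
    (f := fun f α => StrongAlg.coeffCLM W α f) (fun f g h => ?_)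
    (continuous_pi fun α => (StrongAlg.coeffCLM W α).continuous)
  exact StrongAlg.series_injective W (MvPowerSeries.ext fun α => congrFun h α)

/-- `𝓗_p(a, b)` is isometric to `ℓ²`. -/
def Hp.toL2Isometry (p : ℕ) : Hp W p ≃ₗᵢ[ℂ] lp (fun _ : MultiIndex => ℂ) 2 :=
  LinearIsometryEquiv.ofSurjective ⟨Hp.toL2 W p, fun _ => rfl⟩ fun x => by
    have hne : ∀ α, (W.scale p α : ℂ) ≠ 0 := fun α =>
      Complex.ofReal_ne_zero.mpr (W.scale_pos p α).ne'
    refine ⟨⟨fun α => (W.scale p α : ℂ)⁻¹ * x α, (memlp_iff W p _).mp ?_⟩, ?_⟩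
    · convert! lp.memℓp x using 1
      funext α
      exact mul_inv_cancel_left₀ (hne α) _
    · ext α
      exact mul_inv_cancel_left₀ (hne α) _

instance (p : ℕ) : CompleteSpace (Hp W p) :=
  (completeSpace_congr (e := (Hp.toL2Isometry W p).toEquiv)
    (Hp.toL2Isometry W p).isometry.isUniformInducing.isUniformEmbedding).mpr
    inferInstance

/-! ### The weights -/

/-- Iterated supermultiplicativity. As `a_1 > 1`, a suitable power of `a_n` dominates any given
geometric sequence. -/
lemma WeightPair.a_one_pow_le (W : WeightPair) (n : ℕ+) : W.a 1 ^ (n : ℕ) ≤ W.a n := by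
  induction n using PNat.recOn with
  | one => simp
  | succ n ih =>
    refine le_trans ?_ (W.a_mul_le n 1)
    rw [PNat.add_coe, PNat.one_coe, pow_succ]
    exact mul_le_mul_of_nonneg_right ih (W.a_pos 1).le

lemma WeightPair.exists_le_a_one_pow (W : WeightPair) (A : ℝ) : ∃ m : ℕ, A ≤ W.a 1 ^ m := by
  obtain ⟨m, hm⟩ := pow_unbounded_of_one_lt A W.one_lt_a_one
  exact ⟨m, hm.le⟩

lemma WeightPair.exists_inv_b_le (W : WeightPair) : ∃ B : ℝ, 0 ≤ B ∧ ∀ n, (W.b n)⁻¹ ≤ B := by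
  obtain ⟨d, hd, -, hb⟩ := W.exists_summable
  have h0 : ∀ n, 0 ≤ (W.b n ^ d)⁻¹ := fun n => inv_nonneg.mpr (pow_pos (W.b_pos n) d).le
  refine ⟨1 + ∑' n, (W.b n ^ d)⁻¹, add_nonneg zero_le_one (tsum_nonneg h0), fun n => ?_⟩
  have h1 : (W.b n ^ d)⁻¹ ≤ ∑' n, (W.b n ^ d)⁻¹ := hb.le_tsum n fun n _ => h0 n
  rcases le_total (W.b n)⁻¹ 1 with h | h
  · linarith [h0 n]
  · have : (W.b n)⁻¹ ≤ (W.b n)⁻¹ ^ d := le_self_pow₀ h (by omega)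
    rw [inv_pow] at this
    linarith

lemma WeightPair.weight_mul_le (W : WeightPair) (α β : MultiIndex) :
    W.weight α * W.weight β ≤ W.weight (α + β) := by
  have h : (α + β).prod (fun j k => W.a j ^ k) =
      α.prod (fun j k => W.a j ^ k) * β.prod (fun j k => W.a j ^ k) :=
    Finsupp.prod_add_index' (fun _ => pow_zero _) (fun _ _ _ => pow_add _ _ _)
  have hpos : 0 < (α + β).prod (fun j k => W.a j ^ k) :=
    Finset.prod_pos fun _ _ => pow_pos (W.a_pos _) _
  rw [WeightPair.weight, WeightPair.weight, WeightPair.weight, mul_mul_mul_comm, ← h, map_add]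
  exact mul_le_mul_of_nonneg_right (W.b_mul_le _ _) hpos.le

lemma WeightPair.weight_single (W : WeightPair) (j : ℕ+) :
    W.weight (Finsupp.single j 1) = W.b 1 * W.a j := by
  simp [WeightPair.weight]

/-- A uniform bound for all the partial sums of the product of geometric series. -/
lemma sum_prod_pow_le {ι : Type*} (x : ι → ℝ) (hx0 : ∀ j, 0 ≤ x j) (hx : ∀ j, x j ≤ 1 / 2)
    (hs : Summable x) (T : Finset (ι →₀ ℕ)) :
    ∑ α ∈ T, α.prod (fun j k => x j ^ k) ≤ Real.exp (2 * ∑' j, x j) := by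
  classical
  set s : Finset ι := T.biUnion Finsupp.support
  set N : ℕ := T.sup Finsupp.degree
  -- A finite set of multi-indices lies in a box, over which the sum factors into a product of
  -- truncated geometric series.
  have hT : T ⊆ s.finsupp fun _ => Finset.range (N + 1) := by
    intro α hα
    refine Finset.mem_finsupp_iff.mpr ⟨Finset.subset_biUnion_of_mem _ hα, fun i _ => ?_⟩
    rw [Finset.mem_range]
    have h1 : α.degree ≤ N := Finset.le_sup (f := Finsupp.degree) hα
    have h2 : α i ≤ α.degree := Finsupp.le_degree i α
    omega
  -- For `0 ≤ x ≤ 1/2` one has `(1 - x)⁻¹ ≤ 1 + 2x ≤ e^{2x}`.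
  have hgeom : ∀ j, ∑ k ∈ Finset.range (N + 1), x j ^ k ≤ Real.exp (2 * x j) := by
    intro j
    have h1 : x j < 1 := (hx j).trans_lt (by norm_num)
    have h2 : ∑ k ∈ Finset.range (N + 1), x j ^ k ≤ (1 - x j)⁻¹ := by
      rw [← tsum_geometric_of_lt_one (hx0 j) h1]
      exact (summable_geometric_of_lt_one (hx0 j) h1).sum_le_tsum _
        fun _ _ => pow_nonneg (hx0 j) _
    refine h2.trans (le_trans ?_ (Real.add_one_le_exp _))
    rw [inv_le_iff_one_le_mul₀ (by linarith)]
    nlinarith [hx0 j, hx j]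
  calc ∑ α ∈ T, α.prod (fun j k => x j ^ k)
      ≤ ∑ α ∈ s.finsupp fun _ => Finset.range (N + 1), α.prod (fun j k => x j ^ k) :=
        Finset.sum_le_sum_of_subset_of_nonneg hT fun α _ _ =>
          Finset.prod_nonneg fun j _ => pow_nonneg (hx0 j) _
    _ = ∑ α ∈ s.finsupp fun _ => Finset.range (N + 1), ∏ j ∈ s, x j ^ α j := by
        refine Finset.sum_congr rfl fun α hα => ?_
        exact Finsupp.prod_of_support_subset α (Finset.mem_finsupp_iff.mp hα).1 _ (by simp)
    _ = ∏ j ∈ s, ∑ k ∈ Finset.range (N + 1), x j ^ k := by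
        rw [Finset.finsupp, Finset.sum_map, Finset.prod_sum]
        refine Finset.sum_congr (by congr) fun p _ => ?_
        rw [← Finset.prod_attach s]
        refine Finset.prod_congr rfl fun j _ => ?_
        simp
    _ ≤ ∏ j ∈ s, Real.exp (2 * x j) :=
        Finset.prod_le_prod (fun j _ => Finset.sum_nonneg fun k _ => pow_nonneg (hx0 j) _)
          fun j _ => hgeom j
    _ = Real.exp (2 * ∑ j ∈ s, x j) := by rw [← Real.exp_sum, Finset.mul_sum]
    _ ≤ Real.exp (2 * ∑' j, x j) := by
        gcongr
        exact hs.sum_le_tsum s fun j _ => hx0 j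

/-- With `a_1 ^ m ≥ 2` one gets `a_j ^ (-m) ≤ 2 ^ (-j)`, so the sum over all multi-indices is
controlled by a convergent infinite product of geometric series; the factor coming from `b` is
bounded. -/
lemma WeightPair.exists_summable_weight (W : WeightPair) :
    ∃ r : ℕ, Summable fun α : MultiIndex => (W.weight α ^ r)⁻¹ := by
  obtain ⟨m, hm⟩ := W.exists_le_a_one_pow 2
  have hpow : ∀ j : ℕ+, (2 : ℝ) ^ (j : ℕ) ≤ W.a j ^ m := fun j => by
    calc (2 : ℝ) ^ (j : ℕ) ≤ (W.a 1 ^ m) ^ (j : ℕ) := by gcongr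
      _ = (W.a 1 ^ (j : ℕ)) ^ m := by rw [← pow_mul, ← pow_mul, mul_comm]
      _ ≤ W.a j ^ m := pow_le_pow_left₀ (pow_pos (W.a_pos 1) _).le (W.a_one_pow_le j) m
  set x : ℕ+ → ℝ := fun j => (W.a j ^ m)⁻¹ with hxdef
  have hx0 : ∀ j, 0 ≤ x j := fun j => inv_nonneg.mpr (pow_pos (W.a_pos j) m).le
  have hx1 : ∀ j, x j ≤ (1 / 2 : ℝ) ^ (j : ℕ) := fun j => by
    rw [one_div, inv_pow]
    exact inv_anti₀ (by positivity) (hpow j)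
  have hx : ∀ j, x j ≤ 1 / 2 := fun j =>
    (hx1 j).trans (pow_le_of_le_one (by norm_num) (by norm_num) j.ne_zero)
  have hs : Summable x := by
    refine Summable.of_nonneg_of_le hx0 hx1 ?_
    exact (summable_geometric_of_lt_one (by norm_num) (by norm_num)).comp_injective
      PNat.coe_injective
  have hsum : Summable fun α : MultiIndex => α.prod (fun j k => x j ^ k) :=
    summable_of_sum_le (fun α => Finset.prod_nonneg fun j _ => pow_nonneg (hx0 j) _)
      (sum_prod_pow_le x hx0 hx hs)
  obtain ⟨B, -, hB⟩ := W.exists_inv_b_le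
  refine ⟨m, Summable.of_nonneg_of_le (fun α => ?_) (fun α => ?_) (hsum.mul_left (B ^ m))⟩
  · exact inv_nonneg.mpr (pow_pos (W.weight_pos α) m).le
  · rw [WeightPair.weight, mul_pow, mul_inv]
    have h1 : ((α.prod fun j k => W.a j ^ k) ^ m)⁻¹ = α.prod (fun j k => x j ^ k) := by
      simp only [Finsupp.prod, hxdef, ← Finset.prod_pow, ← Finset.prod_inv_distrib]
      refine Finset.prod_congr rfl fun j _ => ?_
      rw [inv_pow, ← pow_mul, ← pow_mul, mul_comm]
    rw [h1, ← inv_pow]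
    refine mul_le_mul_of_nonneg_right (pow_le_pow_left₀ (inv_nonneg.mpr (W.b_pos _).le) (hB _) m)
      (Finset.prod_nonneg fun j _ => pow_nonneg (hx0 j) _)

/-- Weights may be smaller than `1` but are bounded away from `0`, so raising the exponent costs
only a constant. -/
lemma WeightPair.exists_pow_weight_le (W : WeightPair) {k l : ℕ} (h : k ≤ l) :
    ∃ C : ℝ, 0 ≤ C ∧ ∀ α, W.weight α ^ k ≤ C * W.weight α ^ l := by
  obtain ⟨C, hC, hCw⟩ := W.exists_inv_weight_le
  refine ⟨C ^ (l - k), pow_nonneg hC _, fun α => ?_⟩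
  have hw := W.weight_pos α
  have h1 : 1 ≤ C * W.weight α := by
    have := mul_le_mul_of_nonneg_right (hCw α) hw.le
    rwa [inv_mul_cancel₀ hw.ne'] at this
  calc W.weight α ^ k = 1 * W.weight α ^ k := (one_mul _).symm
    _ ≤ (C * W.weight α) ^ (l - k) * W.weight α ^ k := by
        gcongr
        exact one_le_pow₀ h1
    _ = C ^ (l - k) * W.weight α ^ l := by
        rw [mul_pow, mul_assoc, ← pow_add, Nat.sub_add_cancel h]

/-- The number of decompositions `γ = α + β` is at most a power of the weight of `γ`. -/
lemma WeightPair.exists_card_antidiagonal_le (W : WeightPair) :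
    ∃ (C : ℝ) (m : ℕ), 0 ≤ C ∧ ∀ γ : MultiIndex,
      ((Finset.HasAntidiagonal.antidiagonal γ).card : ℝ) ≤ C * W.weight γ ^ m := by
  classical
  obtain ⟨m, hm⟩ := W.exists_le_a_one_pow 2
  obtain ⟨B, hB0, hB⟩ := W.exists_inv_b_le
  refine ⟨B ^ m, m, pow_nonneg hB0 m, fun γ => ?_⟩
  have ha : ∀ j, 2 ≤ W.a j ^ m := fun j => by
    refine hm.trans (pow_le_pow_left₀ (W.a_pos 1).le ?_ m)
    exact (le_self_pow₀ W.one_lt_a_one.le j.ne_zero).trans (W.a_one_pow_le j)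
  have hcard : (Finset.HasAntidiagonal.antidiagonal γ).card ≤ (Finset.Iic γ).card := by
    refine Finset.card_le_card_of_injOn Prod.fst (fun p hp => ?_) fun p hp q hq h => ?_
    · rw [Finset.mem_coe, Finset.HasAntidiagonal.mem_antidiagonal] at hp
      rw [Finset.mem_coe, Finset.mem_Iic, ← hp]
      exact le_self_add
    · rw [Finset.mem_coe, Finset.HasAntidiagonal.mem_antidiagonal] at hp hq
      refine Prod.ext h (add_left_cancel (a := p.1) ?_)
      rw [hp, h, hq]
  -- There are `∏ (γ_j + 1)` multi-indices below `γ`, and `γ_j + 1 ≤ 2 ^ γ_j ≤ a_j ^ (m γ_j)`.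
  have hprod : ((Finset.Iic γ).card : ℝ) ≤ (γ.prod fun j k => W.a j ^ k) ^ m := by
    rw [Finsupp.card_Iic, Nat.cast_prod, Finsupp.prod, ← Finset.prod_pow]
    refine Finset.prod_le_prod (fun _ _ => Nat.cast_nonneg _) fun j _ => ?_
    rw [Nat.card_Iic, ← pow_mul, mul_comm, pow_mul]
    calc ((γ j + 1 : ℕ) : ℝ) ≤ ((2 ^ γ j : ℕ) : ℝ) := by exact_mod_cast Nat.lt_two_pow_self
      _ = 2 ^ γ j := by push_cast; rfl
      _ ≤ (W.a j ^ m) ^ γ j := by gcongr; exact ha j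
  have hb : 1 ≤ B * W.b γ.degree := by
    have := mul_le_mul_of_nonneg_right (hB γ.degree) (W.b_pos γ.degree).le
    rwa [inv_mul_cancel₀ (W.b_pos _).ne'] at this
  have hpos : 0 ≤ (γ.prod fun j k => W.a j ^ k) ^ m :=
    pow_nonneg (Finset.prod_nonneg fun j _ => pow_nonneg (W.a_pos j).le _) m
  calc ((Finset.HasAntidiagonal.antidiagonal γ).card : ℝ) ≤ ((Finset.Iic γ).card : ℝ) := by
        exact_mod_cast hcard
    _ ≤ 1 * (γ.prod fun j k => W.a j ^ k) ^ m := by rw [one_mul]; exact hprod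
    _ ≤ (B * W.b γ.degree) ^ m * (γ.prod fun j k => W.a j ^ k) ^ m :=
        mul_le_mul_of_nonneg_right (one_le_pow₀ hb) hpos
    _ = B ^ m * W.weight γ ^ m := by rw [WeightPair.weight]; ring

/-! ### Monomials in `𝓗_p(a, b)` -/

open Classical in
/-- The series `c z^α` as an element of `𝓗_p(a, b)`. -/
def Hp.mono (p : ℕ) (α : MultiIndex) : ℂ →ₗ[ℂ] Hp W p :=
  (Hp.toL2Isometry W p).symm.toLinearEquiv.toLinearMap ∘ₗ
    lp.lsingle (𝕜 := ℂ) (E := fun _ : MultiIndex => ℂ) 2 α ∘ₗ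
      LinearMap.mulLeft ℂ (W.scale p α : ℂ)

lemma Hp.toL2_apply (p : ℕ) (f : Hp W p) (α : MultiIndex) :
    Hp.toL2 W p f α = (W.scale p α : ℂ) * MvPowerSeries.coeff α (Hp.series W f) := rfl

lemma Hp.norm_mono (p : ℕ) (α : MultiIndex) (c : ℂ) : ‖Hp.mono W p α c‖ = W.scale p α * ‖c‖ := by
  classical
  change ‖(Hp.toL2Isometry W p).symm (lp.single 2 α ((W.scale p α : ℂ) * c))‖ = _
  rw [LinearIsometryEquiv.norm_map, lp.norm_single (by norm_num), norm_mul, Complex.norm_real,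
    Real.norm_of_nonneg (W.scale_pos p α).le]

open Classical in
lemma Hp.coeff_mono (p : ℕ) (α β : MultiIndex) (c : ℂ) :
    MvPowerSeries.coeff β (Hp.series W (Hp.mono W p α c)) = if β = α then c else 0 := by
  have hne : (W.scale p β : ℂ) ≠ 0 := Complex.ofReal_ne_zero.mpr (W.scale_pos p β).ne'
  refine mul_left_cancel₀ hne ?_
  rw [← Hp.toL2_apply]
  have h : Hp.toL2 W p (Hp.mono W p α c) = lp.single 2 α ((W.scale p α : ℂ) * c) :=
    (Hp.toL2Isometry W p).apply_symm_apply _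
  rw [h, lp.single_apply, Pi.single_apply]
  split_ifs with hβ
  · rw [hβ]
  · rw [mul_zero]

/-- For even index the square root disappears, which is why the spaces chosen below are of the form
`𝓗_{2q}`. -/
lemma WeightPair.scale_two_mul (W : WeightPair) (q : ℕ) (α : MultiIndex) :
    W.scale (2 * q) α = (W.weight α ^ q)⁻¹ := by
  rw [WeightPair.scale, mul_comm, pow_mul, Real.sqrt_sq (pow_pos (W.weight_pos α) q).le]

/-! ### Compact subsets of `𝓐` -/

/-- On a compact subset of `𝓐` the coefficients are bounded by a power of the weight. -/
lemma exists_norm_coeff_le_of_isCompact {K : Set (StrongAlg W)} (hK : IsCompact K) :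
    ∃ (C : ℝ) (k : ℕ), 0 ≤ C ∧ ∀ f ∈ K, ∀ α,
      ‖MvPowerSeries.coeff α (StrongAlg.series W f)‖ ≤ C * W.weight α ^ k := by
  -- Unlike the weight itself, `v` is at least `1`, so its powers increase with the exponent.
  set v : MultiIndex → ℝ := fun α => 1 + W.weight α with hv
  have hv1 : ∀ α, 1 ≤ v α := fun α => by simp [hv, (W.weight_pos α).le]
  have hvpos : ∀ α, 0 < v α := fun α => one_pos.trans_le (hv1 α)
  obtain ⟨k, hk⟩ : ∃ k : ℕ, ∀ f ∈ K, ∀ α,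
      ‖MvPowerSeries.coeff α (StrongAlg.series W f)‖ ≤ k * v α ^ k := by
    by_contra! hcon
    choose F hFK A hFA using hcon
    -- If no bound holds, there are `F k ∈ K` and indices `A k` whose coefficients exceed `k * v ^
    -- k`. On a fixed `𝓗_p` the coefficients grow at most like `v ^ p`, so dividing by `v ^ k`
    -- leaves a quantity bounded in `k`: it is harmless for `k ≥ p`, and the finitely many `k < p`
    -- are absorbed by the sum.
    have hbound : ∀ (p k : ℕ) (f : Hp W p),
        ‖((v (A k) ^ k)⁻¹ : ℂ) * MvPowerSeries.coeff (A k) (Hp.series W f)‖ ≤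
          (1 + ∑ i ∈ Finset.range p, v (A i) ^ p) * ‖f‖ := by
      intro p k f
      have hpos := pow_pos (hvpos (A k)) k
      have h1 : ‖MvPowerSeries.coeff (A k) (Hp.series W f)‖ ≤ v (A k) ^ p * ‖f‖ := by
        have h := W.scale_mul_norm_coeff_le f (A k)
        rw [WeightPair.scale, inv_mul_le_iff₀ (Real.sqrt_pos.mpr (pow_pos (W.weight_pos _) p))] at h
        refine h.trans (mul_le_mul_of_nonneg_right ?_ (norm_nonneg f))
        rw [Real.sqrt_le_left (pow_pos (hvpos _) p).le]
        calc W.weight (A k) ^ p ≤ v (A k) ^ p :=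
              pow_le_pow_left₀ (W.weight_pos _).le (by simp [hv]) p
          _ ≤ (v (A k) ^ p) ^ 2 := le_self_pow₀ (one_le_pow₀ (hv1 _)) two_ne_zero
      have h2 : v (A k) ^ p ≤ (1 + ∑ i ∈ Finset.range p, v (A i) ^ p) * v (A k) ^ k := by
        have hS : 0 ≤ ∑ i ∈ Finset.range p, v (A i) ^ p :=
          Finset.sum_nonneg fun i _ => (pow_pos (hvpos _) p).le
        rcases lt_or_ge k p with hkp | hkp
        · have h3 : v (A k) ^ p ≤ ∑ i ∈ Finset.range p, v (A i) ^ p :=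
            Finset.single_le_sum (f := fun i => v (A i) ^ p)
              (fun i _ => (pow_pos (hvpos _) p).le) (Finset.mem_range.mpr hkp)
          nlinarith [one_le_pow₀ (hv1 (A k)) (n := k)]
        · have h3 : v (A k) ^ p ≤ v (A k) ^ k := pow_le_pow_right₀ (hv1 _) hkp
          nlinarith
      rw [norm_mul, norm_inv, norm_pow, Complex.norm_real, Real.norm_of_nonneg (hvpos _).le,
        inv_mul_le_iff₀ hpos]
      calc _ ≤ v (A k) ^ p * ‖f‖ := h1
        _ ≤ ((1 + ∑ i ∈ Finset.range p, v (A i) ^ p) * v (A k) ^ k) * ‖f‖ :=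
            mul_le_mul_of_nonneg_right h2 (norm_nonneg f)
        _ = _ := by ring
    let T : StrongAlg W →ₗ[ℂ] lp (fun _ : ℕ => ℂ) ⊤ :=
      { toFun := fun f => ⟨fun k => ((v (A k) ^ k)⁻¹ : ℂ) *
            MvPowerSeries.coeff (A k) (StrongAlg.series W f), by
          obtain ⟨p, hp⟩ := f.2
          let f' : Hp W p := ⟨f.1, hp⟩
          refine memℓp_infty ⟨(1 + ∑ i ∈ Finset.range p, v (A i) ^ p) *
            ‖f'‖, ?_⟩
          rintro _ ⟨k, rfl⟩
          exact hbound p k f'⟩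
        map_add' := fun f g => by
          ext k
          change (_ : ℂ) = (_ : ℂ) * (_ : ℂ) + (_ : ℂ) * (_ : ℂ)
          simp [mul_add]
        map_smul' := fun c f => by
          ext k
          simp [mul_left_comm] }
    have hT : Continuous T := by
      refine continuous_of_comp_incl W T fun p => ?_
      have hS : 0 ≤ 1 + ∑ i ∈ Finset.range p, v (A i) ^ p :=
        add_nonneg zero_le_one (Finset.sum_nonneg fun i _ => (pow_pos (hvpos _) p).le)
      exact (LinearMap.mkContinuous (T ∘ₗ incl W p) _ fun f =>
        lp.norm_le_of_forall_le (mul_nonneg hS (norm_nonneg f)) fun k => hbound p k f).continuous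
    -- `T` gathers these rescaled coefficients into one continuous map to `ℓ^∞`. It is bounded on
    -- `K`, yet the `k`-th coordinate of `T (F k)` exceeds `k`.
    obtain ⟨R, hR⟩ := (hK.image hT).isBounded.exists_norm_le
    obtain ⟨k, hk⟩ := exists_nat_ge R
    have h1 := lp.norm_apply_le_norm (p := ⊤) (by simp) (T (F k)) k
    have h2 := (h1.trans (hR _ ⟨F k, hFK k, rfl⟩)).trans hk
    have h3 : ‖((v (A k) ^ k)⁻¹ : ℂ) * MvPowerSeries.coeff (A k) (StrongAlg.series W (F k))‖ ≤ k :=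
      h2
    rw [norm_mul, norm_inv, norm_pow, Complex.norm_real, Real.norm_of_nonneg (hvpos _).le,
      inv_mul_le_iff₀ (pow_pos (hvpos _) k), mul_comm] at h3
    exact absurd h3 (not_le.mpr (hFA k))
  obtain ⟨C, hC, hCw⟩ := W.exists_inv_weight_le
  refine ⟨k * (C + 1) ^ k, k, by positivity, fun f hf α => (hk f hf α).trans ?_⟩
  have hw := W.weight_pos α
  have h1 : 1 ≤ C * W.weight α := by
    have := mul_le_mul_of_nonneg_right (hCw α) hw.le
    rwa [inv_mul_cancel₀ hw.ne'] at this
  rw [mul_assoc, ← mul_pow]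
  -- The lower bound on the weight allows a return from `v` to the weight.
  have h2 : v α ≤ (C + 1) * W.weight α := by simp only [hv]; linarith
  have h3 := pow_le_pow_left₀ (hvpos α).le h2 k
  exact mul_le_mul_of_nonneg_left h3 (Nat.cast_nonneg k)

/-! ### Continuous functions with values in `𝓗_p(a, b)` -/

/-- A function into the formal power series with continuous coefficients that are bounded by a
power of the weight is a continuous function into some `𝓗_p(a, b)`. -/
lemma exists_continuousOn_hp {s : Set ℝ} (g : ℝ → Series) (C : ℝ) (k : ℕ)
    (hg : ∀ α, ContinuousOn (fun t => MvPowerSeries.coeff α (g t)) s)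
    (hC : ∀ t ∈ s, ∀ α, ‖MvPowerSeries.coeff α (g t)‖ ≤ C * W.weight α ^ k) :
    ∃ p : ℕ, 1 ≤ p ∧ ∃ G : ℝ → Hp W p, ContinuousOn G s ∧ ∀ t ∈ s, Hp.series W (G t) = g t := by
  obtain ⟨r, hr⟩ := W.exists_summable_weight
  have hr1 : Summable fun α : MultiIndex => (W.weight α ^ (r + 1))⁻¹ := by
    obtain ⟨D, hD, hDw⟩ := W.exists_inv_weight_le
    refine Summable.of_nonneg_of_le (fun α => ?_) (fun α => ?_) (hr.mul_right D)
    · exact inv_nonneg.mpr (pow_pos (W.weight_pos α) _).le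
    · rw [pow_succ, mul_inv]
      exact mul_le_mul_of_nonneg_left (hDw α) (inv_nonneg.mpr (pow_pos (W.weight_pos α) _).le)
  -- The norm of `c z^α` in `𝓗_{2q}` is `‖c‖` divided by the `q`-th power of the weight: `k` powers
  -- cancel the hypothesis and `r + 1` remain for the Weierstrass test. Taking `r + 1` rather than
  -- `r` makes `1 ≤ p` evident.
  set p := 2 * (k + (r + 1)) with hp
  have hnorm : ∀ t ∈ s, ∀ α,
      ‖Hp.mono W p α (MvPowerSeries.coeff α (g t))‖ ≤ C * (W.weight α ^ (r + 1))⁻¹ := by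
    intro t ht α
    have hw := W.weight_pos α
    rw [Hp.norm_mono, hp, W.scale_two_mul, inv_mul_le_iff₀ (pow_pos hw _)]
    refine (hC t ht α).trans (le_of_eq ?_)
    rw [pow_add]
    field_simp
  refine ⟨p, by omega, fun t => ∑' α, Hp.mono W p α (MvPowerSeries.coeff α (g t)), ?_, ?_⟩
  · refine continuousOn_tsum (fun α => ?_) (hr1.mul_left C) fun α t ht => hnorm t ht α
    have hc : Continuous (Hp.mono W p α) :=
      (LinearMap.mkContinuous (Hp.mono W p α) _ fun c => (Hp.norm_mono W p α c).le).continuous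
    exact hc.comp_continuousOn (hg α)
  · intro t ht
    have hsum : Summable fun α => Hp.mono W p α (MvPowerSeries.coeff α (g t)) :=
      Summable.of_norm_bounded (hr1.mul_left C) (hnorm t ht)
    refine MvPowerSeries.ext fun β => ?_
    rw [← Hp.coeffCLM_apply, (Hp.coeffCLM W p β).map_tsum hsum]
    classical
    simp only [Hp.coeffCLM_apply, Hp.coeff_mono, eq_comm (a := β)]
    exact tsum_ite_eq β _

/-! ### Riemann integrals of continuous functions -/

lemma hasRiemannIntegral_intervalIntegral {E : Type*} [NormedAddCommGroup E] [NormedSpace ℝ E]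
    [CompleteSpace E] {G : ℝ → E} {u v : ℝ} (huv : u ≤ v) (hG : ContinuousOn G (Set.Icc u v)) :
    HasRiemannIntegral G u v (∫ t in u..v, G t) := by
  intro U hU
  obtain ⟨ε, hε, hεU⟩ := Metric.mem_nhds_iff.mp hU
  have huv' : 0 < v - u + 1 := by linarith
  have huc := isCompact_Icc.uniformContinuousOn_of_continuous hG
  -- The summand `1` covers the case `u = v` and makes the final estimate strict.
  obtain ⟨δ, hδ, huc⟩ := Metric.uniformContinuousOn_iff.mp huc (ε / (v - u + 1)) (by positivity)
  refine ⟨δ, hδ, fun n x ξ hx hx0 hxn hξ hmesh => hεU ?_⟩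
  -- The partition is continued as a constant sequence on `ℕ`, to which the telescoping lemmas
  -- apply.
  set y : ℕ → ℝ := fun k => x ⟨min k n, by omega⟩ with hy
  have hyc : ∀ i : Fin n, y i = x i.castSucc := fun i => by
    simp only [hy]
    congr 1
    ext
    simp [i.2.le]
  have hys : ∀ i : Fin n, y (i + 1) = x i.succ := fun i => by
    simp only [hy]
    congr 1
    ext
    simp only [Fin.val_succ]
    omega
  have hy0 : y 0 = u := by rw [← hx0]; simp [hy]
  have hyn : y n = v := by
    rw [← hxn]
    simp only [hy]
    congr 1
    ext
    simp
  have hxmem : ∀ i, x i ∈ Set.Icc u v := fun i =>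
    ⟨hx0 ▸ hx (Fin.zero_le i), hxn ▸ hx (Fin.le_last i)⟩
  have hint : ∀ i : Fin n, IntervalIntegrable G volume (x i.castSucc) (x i.succ) := fun i => by
    refine (hG.mono ?_).intervalIntegrable
    rw [Set.uIcc_of_le (hx i.castSucc_le_succ)]
    exact Set.Icc_subset_Icc (hxmem _).1 (hxmem _).2
  have hsum : ∫ t in u..v, G t = ∑ i : Fin n, ∫ t in (x i.castSucc)..(x i.succ), G t := by
    rw [← hy0, ← hyn, ← intervalIntegral.sum_integral_adjacent_intervals, Finset.sum_range]
    · simp only [hyc, hys]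
    · intro k hk
      have := hint ⟨k, hk⟩
      rwa [← hyc, ← hys] at this
  have hlen : ∑ i : Fin n, (x i.succ - x i.castSucc) = v - u := by
    have := Finset.sum_range_sub y n
    rw [hy0, hyn, Finset.sum_range] at this
    simpa only [hyc, hys] using this
  have hdiff : ∀ i : Fin n, ‖(x i.succ - x i.castSucc) • G (ξ i) -
      ∫ t in (x i.castSucc)..(x i.succ), G t‖ ≤
        ε / (v - u + 1) * (x i.succ - x i.castSucc) := fun i => by
    have hle : x i.castSucc ≤ x i.succ := hx i.castSucc_le_succ
    rw [← intervalIntegral.integral_const, ← intervalIntegral.integral_sub (by simp) (hint i)]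
    refine (intervalIntegral.norm_integral_le_of_norm_le_const
      (C := ε / (v - u + 1)) fun t ht => ?_).trans_eq ?_
    · rw [Set.uIoc_of_le hle] at ht
      rw [← dist_eq_norm]
      have h1 := hξ i
      have h2 := hmesh i
      refine (huc _ ⟨(hxmem _).1.trans h1.1, h1.2.trans (hxmem _).2⟩ _
        ⟨(hxmem _).1.trans ht.1.le, ht.2.trans (hxmem _).2⟩ ?_).le
      rw [Real.dist_eq, abs_lt]
      constructor <;> linarith [h1.1, h1.2, ht.1, ht.2]
    · rw [abs_of_nonneg (sub_nonneg.mpr hle)]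
  rw [Metric.mem_ball, dist_eq_norm, hsum, ← Finset.sum_sub_distrib]
  calc _ ≤ ∑ i : Fin n, ε / (v - u + 1) * (x i.succ - x i.castSucc) :=
        norm_sum_le_of_le _ fun i _ => hdiff i
    _ = ε * ((v - u) / (v - u + 1)) := by rw [← Finset.mul_sum, hlen]; ring
    _ < ε * 1 := by
        refine mul_lt_mul_of_pos_left ?_ hε
        rw [div_lt_one huv']
        linarith
    _ = ε := mul_one ε

lemma HasRiemannIntegral.map {E F : Type*} [AddCommGroup E] [Module ℝ E] [TopologicalSpace E]
    [AddCommGroup F] [Module ℝ F] [TopologicalSpace F] {g : ℝ → E} {u v : ℝ} {I : E}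
    (h : HasRiemannIntegral g u v I) (T : E →ₗ[ℝ] F) (hT : Continuous T) :
    HasRiemannIntegral (fun t => T (g t)) u v (T I) := by
  intro U hU
  obtain ⟨δ, hδ, hsum⟩ := h _ (hT.continuousAt hU)
  refine ⟨δ, hδ, fun n x ξ hx hx0 hxn hξ hmesh => ?_⟩
  have := hsum n x ξ hx hx0 hxn hξ hmesh
  simpa only [Set.mem_preimage, map_sum, map_smul] using this

/-- One sufficiently fine equidistant partition would have its Riemann sum in two disjoint
neighbourhoods. -/
lemma HasRiemannIntegral.unique {E : Type*} [AddCommGroup E] [Module ℝ E] [TopologicalSpace E]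
    [T2Space E] {g : ℝ → E} {u v : ℝ} (huv : u ≤ v) {I J : E} (hI : HasRiemannIntegral g u v I)
    (hJ : HasRiemannIntegral g u v J) : I = J := by
  by_contra hne
  obtain ⟨U, V, hU, hV, hIU, hJV, hd⟩ := t2_separation hne
  obtain ⟨δ, hδ, hsumU⟩ := hI U (hU.mem_nhds hIU)
  obtain ⟨η, hη, hsumV⟩ := hJ V (hV.mem_nhds hJV)
  obtain ⟨n, hn⟩ := exists_nat_gt ((v - u) / min δ η)
  have hm : 0 < min δ η := lt_min hδ hη
  have hn0 : (0 : ℝ) < n := (div_nonneg (by linarith) hm.le).trans_lt hn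
  set x : Fin (n + 1) → ℝ := fun i => u + (i : ℕ) * ((v - u) / n) with hx
  have hstep : 0 ≤ (v - u) / n := div_nonneg (by linarith) hn0.le
  have hdiff : ∀ i : Fin n, x i.succ - x i.castSucc = (v - u) / n := fun i => by
    simp only [hx, Fin.val_succ, Fin.val_castSucc]
    push_cast
    ring
  have hlt : (v - u) / n < min δ η := by
    rw [div_lt_iff₀ hn0]
    rwa [div_lt_iff₀ hm, mul_comm] at hn
  have hmono : Monotone x := fun i j hij => by
    simp only [hx]
    gcongr
    exact hij
  have h0 : x 0 = u := by simp [hx]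
  have hlast : x (Fin.last n) = v := by
    simp only [hx, Fin.val_last]
    field_simp
    ring
  have hξ : ∀ i : Fin n, x i.castSucc ∈ Set.Icc (x i.castSucc) (x i.succ) := fun i =>
    ⟨le_rfl, hmono i.castSucc_le_succ⟩
  exact Set.disjoint_left.mp hd
    (hsumU n x (fun i => x i.castSucc) hmono h0 hlast hξ fun i => by
      rw [hdiff]; exact hlt.trans_le (min_le_left _ _))
    (hsumV n x (fun i => x i.castSucc) hmono h0 hlast hξ fun i => by
      rw [hdiff]; exact hlt.trans_le (min_le_right _ _))

/-! ### Hermite polynomials and Hermite functions -/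

section Hermite
open Polynomial

lemma derivative_hermite_succ (n : ℕ) :
    derivative (hermite (n + 1)) = ((n + 1 : ℕ) : ℤ[X]) * hermite n := by
  induction n with
  | zero => simp
  | succ n ih =>
    rw [hermite_succ (n + 1), derivative_sub, derivative_mul, derivative_X, ih, derivative_mul,
      derivative_natCast, hermite_succ n]
    push_cast
    ring

lemma hermite_succ_succ (n : ℕ) :
    hermite (n + 2) = X * hermite (n + 1) - ((n + 1 : ℕ) : ℤ[X]) * hermite n := by
  rw [hermite_succ (n + 1), derivative_hermite_succ]

/-- Follows from the three-term recurrence. The factor `√n!` is exactly what the normalisation of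
`ζ_{n+1}` cancels, leaving geometric growth. -/
lemma abs_aeval_hermite_le (n : ℕ) (y : ℝ) :
    |aeval y (hermite n)| ≤ √(n.factorial : ℝ) * (1 + |y|) ^ n := by
  induction n using Nat.twoStepInduction with
  | zero => simp
  | one => simp
  | more n ih0 ih1 =>
    have hy := abs_nonneg y
    have h1 : √((n + 1).factorial : ℝ) = √(n + 1) * √(n.factorial : ℝ) := by
      rw [Nat.factorial_succ]
      push_cast
      exact Real.sqrt_mul (by positivity) _
    have h2 : √((n + 2).factorial : ℝ) = √(n + 2) * √((n + 1).factorial : ℝ) := by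
      rw [Nat.factorial_succ]
      push_cast
      rw [Real.sqrt_mul (by positivity)]
      ring_nf
    have h3 : √((n : ℝ) + 1) ≤ √(n + 2) := Real.sqrt_le_sqrt (by linarith)
    have h4 : (1 : ℝ) ≤ √(n + 2) := by
      rw [Real.one_le_sqrt]
      linarith [(Nat.cast_nonneg n : (0 : ℝ) ≤ n)]
    have h5 : √((n : ℝ) + 1) * √(n + 1) = n + 1 := Real.mul_self_sqrt (by positivity)
    rw [hermite_succ_succ]
    simp only [map_sub, map_mul, aeval_X, map_natCast]
    calc |y * aeval y (hermite (n + 1)) - ((n + 1 : ℕ) : ℝ) * aeval y (hermite n)|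
        ≤ |y| * |aeval y (hermite (n + 1))| + (n + 1) * |aeval y (hermite n)| := by
          refine (abs_sub _ _).trans (le_of_eq ?_)
          rw [abs_mul, abs_mul, Nat.abs_cast]
          push_cast
          rfl
      _ ≤ |y| * (√((n + 1).factorial : ℝ) * (1 + |y|) ^ (n + 1)) +
            (n + 1) * (√(n.factorial : ℝ) * (1 + |y|) ^ n) := by gcongr
      -- Since `(n + 1) √n! = √(n + 1) √(n + 1)!`, both terms share the same factor.
      _ = √((n + 1).factorial : ℝ) * (1 + |y|) ^ n * (|y| * (1 + |y|)) +
            √((n + 1).factorial : ℝ) * (1 + |y|) ^ n * √(n + 1) := by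
          rw [h1]
          linear_combination (-√(n.factorial : ℝ) * (1 + |y|) ^ n) * h5
      _ ≤ √((n + 1).factorial : ℝ) * (1 + |y|) ^ n * (√(n + 2) * (|y| * (1 + |y|))) +
            √((n + 1).factorial : ℝ) * (1 + |y|) ^ n * √(n + 2) := by
          refine add_le_add (mul_le_mul_of_nonneg_left ?_ (by positivity)) (by gcongr)
          exact le_mul_of_one_le_left (mul_nonneg hy (add_nonneg zero_le_one hy)) h4
      _ = √((n + 2).factorial : ℝ) * (1 + |y|) ^ n * (|y| * (1 + |y|) + 1) := by rw [h2]; ring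
      _ ≤ √((n + 2).factorial : ℝ) * (1 + |y|) ^ n * (1 + |y|) ^ 2 := by
          gcongr
          nlinarith
      _ = _ := by ring

lemma integrable_poly_mul_gaussian (p : ℝ[X]) :
    Integrable fun x : ℝ => p.eval x * Real.exp (-(x ^ 2 / 2)) := by
  have h := (SchwartzMap.smulLeftCLM ℝ (fun x : ℝ => p.eval x) gaussianSchwartz).integrable
    (μ := volume)
  refine h.congr (Eventually.of_forall fun x => ?_)
  rw [SchwartzMap.smulLeftCLM_apply_apply (hasTemperateGrowth_poly p), smul_eq_mul]
  rfl

/-- The difference of the integrands is the derivative of `p(x) e^{-x²/2}`, which is integrable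
together with its derivative. -/
lemma integral_derivative_mul_gaussian (p : ℝ[X]) :
    ∫ x : ℝ, (derivative p).eval x * Real.exp (-(x ^ 2 / 2)) =
      ∫ x : ℝ, (X * p).eval x * Real.exp (-(x ^ 2 / 2)) := by
  rw [← sub_eq_zero, ← integral_sub (integrable_poly_mul_gaussian _)
    (integrable_poly_mul_gaussian _)]
  refine integral_eq_zero_of_hasDerivAt_of_integrable
    (f := fun x => p.eval x * Real.exp (-(x ^ 2 / 2))) (fun x => ?_)
    ((integrable_poly_mul_gaussian _).sub (integrable_poly_mul_gaussian _))
    (integrable_poly_mul_gaussian p)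
  have h1 : HasDerivAt (fun x : ℝ => -(x ^ 2 / 2)) (-x) x := by
    have := ((hasDerivAt_pow 2 x).div_const 2).neg
    convert! this using 1
    simp
  convert! (p.hasDerivAt x).mul h1.exp using 1
  simp
  ring

lemma integral_hermite_mul_hermite (m n : ℕ) :
    ∫ x : ℝ, aeval x (hermite m) * aeval x (hermite n) * Real.exp (-(x ^ 2 / 2)) =
      if m = n then n.factorial * √(2 * Real.pi) else 0 := by
  have hev : ∀ (k : ℕ) (x : ℝ),
      aeval x (hermite k) = ((hermite k).map (Int.castRingHom ℝ)).eval x := fun k x => by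
    rw [eval_map, aeval_def, algebraMap_int_eq]
  -- As `H_{k+1} = X H_k - H_k'`, integration by parts moves one derivative onto `r`; with `H_{m+1}'
  -- = (m + 1) H_m` this lowers both degrees by one.
  have step : ∀ (r : ℝ[X]) (k : ℕ),
      ∫ x : ℝ, r.eval x * aeval x (hermite (k + 1)) * Real.exp (-(x ^ 2 / 2)) =
        ∫ x : ℝ, (derivative r).eval x * aeval x (hermite k) * Real.exp (-(x ^ 2 / 2)) := by
    intro r k
    have h := integral_derivative_mul_gaussian (r * (hermite k).map (Int.castRingHom ℝ))
    simp only [derivative_mul, eval_add, add_mul] at h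
    have hi1 := integrable_poly_mul_gaussian (derivative r * (hermite k).map (Int.castRingHom ℝ))
    have hi2 := integrable_poly_mul_gaussian (r * derivative ((hermite k).map (Int.castRingHom ℝ)))
    have hi3 := integrable_poly_mul_gaussian (X * (r * (hermite k).map (Int.castRingHom ℝ)))
    rw [integral_add hi1 hi2, ← eq_sub_iff_add_eq, ← integral_sub hi3 hi2] at h
    simp only [hev]
    simp only [eval_mul] at h
    rw [h]
    refine integral_congr_ae (Eventually.of_forall fun x => ?_)
    simp only [hermite_succ, Polynomial.map_sub, Polynomial.map_mul, map_X, eval_sub, eval_mul,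
      eval_X, derivative_map]
    ring
  induction n generalizing m with
  | zero =>
    cases m with
    | zero =>
      have := integral_gaussian (1 / 2)
      simp only [hermite_zero, map_one, one_mul, if_true, Nat.factorial_zero, Nat.cast_one]
      rw [show (2 : ℝ) * Real.pi = Real.pi / (1 / 2) by ring, ← this]
      refine integral_congr_ae (Eventually.of_forall fun x => ?_)
      beta_reduce
      congr 1
      ring
    | succ m =>
      have := step 1 m
      simp only [derivative_one, eval_zero, eval_one, zero_mul, integral_zero, one_mul] at this
      simpa using this
  | succ n ih =>
    have := step ((hermite m).map (Int.castRingHom ℝ)) n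
    simp only [← hev] at this
    rw [this]
    cases m with
    | zero => simp
    | succ m =>
      have h1 : ∀ x : ℝ, (derivative ((hermite (m + 1)).map (Int.castRingHom ℝ))).eval x =
          (m + 1) * aeval x (hermite m) := fun x => by
        rw [derivative_map, derivative_hermite_succ, hev]
        simp
      simp only [h1, mul_assoc, integral_const_mul]
      have h2 := ih m
      simp only [mul_assoc] at h2
      rw [h2]
      by_cases hmn : m = n
      · subst hmn
        simp [Nat.factorial_succ, mul_assoc]
      · simp [hmn]

end Hermite

/-- The two Gaussian factors combine to `e^{-x²}`, so the substitution `y = √2 x` reduces to Hermite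
orthogonality. -/
lemma integral_hermiteFun_mul (i j : ℕ+) :
    ∫ x : ℝ, hermiteFun i x * hermiteFun j x = if i = j then 1 else 0 := by
  set c : ℕ+ → ℝ := fun k => Real.pi ^ (-(1 / 4) : ℝ) * (√((k.natPred).factorial : ℝ))⁻¹ with hc
  set F : ℝ → ℝ := fun y => Polynomial.aeval y (Polynomial.hermite i.natPred) *
    Polynomial.aeval y (Polynomial.hermite j.natPred) * Real.exp (-(y ^ 2 / 2)) with hF
  have h1 : ∀ x, hermiteFun i x * hermiteFun j x = c i * c j * F (√2 * x) := fun x => by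
    simp only [hermiteFun, hc, hF, mul_pow, Real.sq_sqrt zero_le_two]
    rw [show -(2 * x ^ 2 / 2) = -(x ^ 2 / 2) + -(x ^ 2 / 2) by ring, Real.exp_add]
    ring
  simp only [h1]
  rw [integral_const_mul, Measure.integral_comp_mul_left, integral_hermite_mul_hermite]
  have hij : i.natPred = j.natPred ↔ i = j := PNat.natPred_inj
  simp only [hij]
  split_ifs with h
  · subst h
    have hfac : (0 : ℝ) < i.natPred.factorial := by positivity
    have hpi : Real.pi ^ (-(1 / 4) : ℝ) * Real.pi ^ (-(1 / 4) : ℝ) = (√Real.pi)⁻¹ := by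
      rw [← Real.rpow_add Real.pi_pos, Real.sqrt_eq_rpow, ← Real.rpow_neg Real.pi_pos.le]
      norm_num
    have hff : (√(i.natPred.factorial : ℝ))⁻¹ * (√(i.natPred.factorial : ℝ))⁻¹ =
        (i.natPred.factorial : ℝ)⁻¹ := by
      rw [← mul_inv, Real.mul_self_sqrt hfac.le]
    have hcc : c i * c i = (√Real.pi)⁻¹ * (i.natPred.factorial : ℝ)⁻¹ := by
      rw [← hpi, ← hff]
      ring
    rw [hcc, Real.sqrt_mul zero_le_two, smul_eq_mul, abs_of_pos (by positivity)]
    have := Real.sqrt_pos.mpr Real.pi_pos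
    have h2 : (0 : ℝ) < √2 := by positivity
    field_simp
  · simp

lemma abs_hermiteFun_le (j : ℕ+) (t : ℝ) : |hermiteFun j t| ≤ (1 + √2 * |t|) ^ (j : ℕ) := by
  have hf : 0 < √((j.natPred).factorial : ℝ) := by positivity
  have h1 := abs_aeval_hermite_le j.natPred (√2 * t)
  rw [abs_mul, abs_of_nonneg (Real.sqrt_nonneg 2)] at h1
  have h2 : Real.pi ^ (-(1 / 4) : ℝ) ≤ 1 :=
    Real.rpow_le_one_of_one_le_of_nonpos (by linarith [Real.pi_gt_three]) (by norm_num)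
  have h3 : Real.exp (-(t ^ 2 / 2)) ≤ 1 := Real.exp_le_one_iff.mpr (by nlinarith [sq_nonneg t])
  have h4 : 0 < Real.pi ^ (-(1 / 4) : ℝ) := Real.rpow_pos_of_pos Real.pi_pos _
  have h5 : 1 ≤ 1 + √2 * |t| := le_add_of_nonneg_right (by positivity)
  rw [hermiteFun, abs_mul, abs_of_pos (by positivity)]
  calc _ ≤ 1 * (√((j.natPred).factorial : ℝ))⁻¹ * 1 *
        (√((j.natPred).factorial : ℝ) * (1 + √2 * |t|) ^ j.natPred) := by gcongr
    _ = (1 + √2 * |t|) ^ j.natPred := by field_simp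
    _ ≤ (1 + √2 * |t|) ^ (j : ℕ) := pow_le_pow_right₀ h5 (by rw [← j.natPred_add_one]; omega)

lemma continuous_hermiteFun (j : ℕ+) : Continuous (hermiteFun j) := (hermiteSchwartz j).continuous

/-! ### The joint law of the random variables `⟨·, s⟩` -/

lemma TemperedDual.measurable_pair (s : 𝓢(ℝ, ℝ)) :
    Measurable fun ω : TemperedDual => ω.pair s :=
  (comap_measurable _).mono (le_iSup (fun s : 𝓢(ℝ, ℝ) =>
    MeasurableSpace.comap (fun ω : TemperedDual => ω.pair s) inferInstance) s) le_rfl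

lemma TemperedDual.pair_smul (ω : TemperedDual) (c : ℝ) (s : 𝓢(ℝ, ℝ)) :
    ω.pair (c • s) = c * ω.pair s := by
  unfold TemperedDual.pair
  rw [map_smul, smul_eq_mul]

lemma TemperedDual.pair_sum_smul {ι : Type*} [Fintype ι] (ω : TemperedDual) (u : ι → ℝ)
    (s : ι → 𝓢(ℝ, ℝ)) : ω.pair (∑ i, u i • s i) = ∑ i, u i * ω.pair (s i) := by
  unfold TemperedDual.pair
  rw [map_sum]
  exact Finset.sum_congr rfl fun i _ => ω.pair_smul (u i) (s i)

lemma l2NormSq_sum_smul {ι : Type*} [Fintype ι] (u : ι → ℝ) (s : ι → 𝓢(ℝ, ℝ)) :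
    l2NormSq (∑ i, u i • s i) = ∑ i, ∑ j, u i * u j * ∫ x, s i x * s j x := by
  have hint : ∀ i j, Integrable fun x => s i x * s j x := fun i j =>
    ((s i).memLp 2 volume).integrable_mul ((s j).memLp 2 volume)
  have h : ∀ x, (∑ i, u i • s i) x ^ 2 = ∑ i, ∑ j, u i * u j * (s i x * s j x) := fun x => by
    rw [_root_.sum_apply, sq, Finset.sum_mul_sum]
    refine Finset.sum_congr rfl fun i _ => Finset.sum_congr rfl fun j _ => ?_
    simp only [_root_.smul_apply, smul_eq_mul]
    ring
  simp only [l2NormSq, h]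
  rw [integral_finsetSum _ fun i _ => integrable_finsetSum _ fun j _ => (hint i j).const_mul _]
  refine Finset.sum_congr rfl fun i _ => ?_
  rw [integral_finsetSum _ fun j _ => (hint i j).const_mul _]
  simp only [integral_const_mul]

/-- The random vector `(⟨ω, s_i⟩)_i`. -/
def pairVec {ι : Type*} (s : ι → 𝓢(ℝ, ℝ)) (ω : TemperedDual) : EuclideanSpace ℝ ι :=
  WithLp.toLp 2 fun i => ω.pair (s i)

lemma measurable_pairVec {ι : Type*} [Fintype ι] (s : ι → 𝓢(ℝ, ℝ)) : Measurable (pairVec s) :=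
  (WithLp.measurable_toLp 2 _).comp (measurable_pi_lambda _ fun i =>
    TemperedDual.measurable_pair (s i))

/-- The law of `(⟨ω, s_i⟩)_i` depends only on the Gram matrix of the `s_i` in `L²(ℝ)`. -/
lemma IsMLMeasure.map_pairVec_eq {φ : ℂ → ℂ} {P : Measure TemperedDual} (hP : IsMLMeasure φ P)
    {ι : Type*} [Fintype ι] {s s' : ι → 𝓢(ℝ, ℝ)}
    (h : ∀ i j, ∫ x, s i x * s j x = ∫ x, s' i x * s' j x) :
    P.map (pairVec s) = P.map (pairVec s') := by
  have := hP.isProbabilityMeasure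
  -- The characteristic function at `u` is the characteristic functional at `∑ u_i s_i`, whose
  -- squared norm is the quadratic form of the Gram matrix.
  have hchar : ∀ (s : ι → 𝓢(ℝ, ℝ)) (u : EuclideanSpace ℝ ι),
      charFun (P.map (pairVec s)) u =
        φ (-((∑ i, ∑ j, u i * u j * ∫ x, s i x * s j x : ℝ) : ℂ) / 2) := fun s u => by
    rw [charFun_apply, integral_map (measurable_pairVec s).aemeasurable
      (by fun_prop), ← l2NormSq_sum_smul, ← hP.charFunctional]
    refine integral_congr_ae (Eventually.of_forall fun ω => ?_)
    have h1 : ⟪pairVec s ω, u⟫_ℝ = ω.pair (∑ i, u i • s i) := by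
      rw [TemperedDual.pair_sum_smul, PiLp.inner_apply]
      simp [pairVec]
    simp only [h1, mul_comm]
  have hfin : ∀ s : ι → 𝓢(ℝ, ℝ), IsProbabilityMeasure (P.map (pairVec s)) := fun s =>
    Measure.isProbabilityMeasure_map (measurable_pairVec s).aemeasurable
  have h1 := hfin s
  have h2 := hfin s'
  refine Measure.ext_of_charFun (funext fun u => ?_)
  rw [hchar, hchar]
  simp only [h]

lemma hermiteSchwartz_apply (j : ℕ+) (x : ℝ) : hermiteSchwartz j x = hermiteFun j x := rfl

lemma monomialFun_single (j : ℕ+) (ω : TemperedDual) :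
    monomialFun (Finsupp.single j 1) ω = ((ω.pair (hermiteSchwartz j) : ℝ) : ℂ) := by
  simp [monomialFun]

/-- `Q_j` is orthogonal to the monomials in the other variables, as the joint law is invariant
under `Q_j ↦ -Q_j`. -/
lemma IsMLMeasure.integral_conj_monomialFun_mul {φ : ℂ → ℂ} {P : Measure TemperedDual}
    (hP : IsMLMeasure φ P) {δ : MultiIndex} {j : ℕ+} (hδ : δ j = 0) :
    ∫ ω, monomialFun (Finsupp.single j 1) ω * (starRingEnd ℂ) (monomialFun δ ω) ∂P = 0 := by
  classical
  set S : Finset ℕ+ := insert j δ.support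
  set e : S → ℝ := fun i => if (i : ℕ+) = j then -1 else 1 with he
  set s : S → 𝓢(ℝ, ℝ) := fun i => hermiteSchwartz i
  set s' : S → 𝓢(ℝ, ℝ) := fun i => e i • hermiteSchwartz i
  -- Flipping the sign of `ζ_j` preserves the Gram matrix: off-diagonal entries vanish and diagonal
  -- signs square to `1`.
  have hlaw : P.map (pairVec s) = P.map (pairVec s') := hP.map_pairVec_eq fun i k => by
    have h1 : ∀ x, s' i x * s' k x = e i * e k * (hermiteFun i x * hermiteFun k x) := fun x => by
      simp only [s', _root_.smul_apply, smul_eq_mul, hermiteSchwartz_apply]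
      ring
    simp only [h1, integral_const_mul, s, hermiteSchwartz_apply, integral_hermiteFun_mul]
    split_ifs with hik
    · have : e i = e k := by rw [he]; simp only [hik]
      rw [this, he]
      dsimp only
      split_ifs <;> norm_num
    · rw [mul_zero]
  let j' : S := ⟨j, Finset.mem_insert_self j _⟩
  let F : EuclideanSpace ℝ S → ℂ := fun x =>
    ((x j' : ℝ) : ℂ) * (starRingEnd ℂ) (∏ i : S, ((x i : ℝ) : ℂ) ^ δ i)
  have hF : Continuous F := by
    refine Continuous.mul (by fun_prop) (RCLike.continuous_conj.comp ?_)
    fun_prop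
  have hmono : ∀ ω, monomialFun δ ω = ∏ i : S, ((ω.pair (s i) : ℝ) : ℂ) ^ δ i := fun ω => by
    rw [monomialFun, Finsupp.prod_of_support_subset δ (Finset.subset_insert j _) _ (by simp),
      ← Finset.prod_coe_sort]
  have hFs : ∀ ω, F (pairVec s ω) =
      monomialFun (Finsupp.single j 1) ω * (starRingEnd ℂ) (monomialFun δ ω) := fun ω => by
    rw [hmono, monomialFun_single]
    rfl
  have hFs' : ∀ ω, F (pairVec s' ω) = -F (pairVec s ω) := fun ω => by
    have h0 : ∀ i, pairVec s' ω i = e i * pairVec s ω i := fun i => ω.pair_smul _ _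
    have h1 : ((pairVec s' ω j' : ℝ) : ℂ) = -((pairVec s ω j' : ℝ) : ℂ) := by
      simp [h0, e, j']
    have h2 : ∀ i : S, ((pairVec s' ω i : ℝ) : ℂ) ^ δ i = ((pairVec s ω i : ℝ) : ℂ) ^ δ i := by
      intro i
      by_cases hi : (i : ℕ+) = j
      · rw [hi, hδ, pow_zero, pow_zero]
      · simp [h0, e, hi]
    simp only [F, h1, h2, neg_mul]
  -- Only equality of the laws enters, so integrability need not be checked. Since `δ j = 0`, `F` is
  -- odd under the flip and the integral equals its own negative.
  have hint : ∫ ω, F (pairVec s ω) ∂P = ∫ ω, F (pairVec s' ω) ∂P := by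
    rw [← integral_map (measurable_pairVec s).aemeasurable hF.aestronglyMeasurable, hlaw,
      integral_map (measurable_pairVec s').aemeasurable hF.aestronglyMeasurable]
  simp only [hFs', integral_neg, hFs] at hint
  exact self_eq_neg.mp hint

lemma IsMLMeasure.inner_monomialLp_single {φ : ℂ → ℂ} {P : Measure TemperedDual}
    (hP : IsMLMeasure φ P) {δ : MultiIndex} {j : ℕ+} (hδ : δ j = 0) :
    ⟪monomialLp P δ, monomialLp P (Finsupp.single j 1)⟫_ℂ = 0 := by
  unfold monomialLp
  split_ifs with h1 h2
  · rw [L2.inner_def, ← hP.integral_conj_monomialFun_mul hδ]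
    refine integral_congr_ae ?_
    filter_upwards [h1.coeFn_toLp, h2.coeFn_toLp] with ω hω1 hω2
    rw [hω1, hω2, RCLike.inner_apply]
  -- A monomial outside `L²` has class `0`.
  all_goals simp

/-- All `Q_j` have the same law because the `ζ_j` are unit vectors. What matters is that the bound
does not depend on `j`. -/
lemma IsMLMeasure.norm_monomialLp_single_le {φ : ℂ → ℂ} {P : Measure TemperedDual}
    (hP : IsMLMeasure φ P) (j : ℕ+) :
    ‖monomialLp P (Finsupp.single j 1)‖ ≤
      (eLpNorm (monomialFun (Finsupp.single 1 1)) 2 P).toReal := by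
  have hlaw : ∀ j : ℕ+, eLpNorm (monomialFun (Finsupp.single j 1)) 2 P =
      eLpNorm (fun x : EuclideanSpace ℝ Unit => ((x () : ℝ) : ℂ)) 2
        (P.map (pairVec fun _ : Unit => hermiteSchwartz j)) := fun j => by
    have hF : Continuous fun x : EuclideanSpace ℝ Unit => ((x () : ℝ) : ℂ) := by fun_prop
    rw [eLpNorm_map_measure hF.aestronglyMeasurable (measurable_pairVec _).aemeasurable]
    congr 1
    funext ω
    exact monomialFun_single j ω
  have heq : P.map (pairVec fun _ : Unit => hermiteSchwartz j) =
      P.map (pairVec fun _ : Unit => hermiteSchwartz 1) :=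
    hP.map_pairVec_eq fun _ _ => by
      simp only [hermiteSchwartz_apply, integral_hermiteFun_mul, if_true]
  rw [hlaw 1, ← heq, ← hlaw j, monomialLp]
  split_ifs with h
  · rw [Lp.norm_toLp]
  · rw [norm_zero]
    exact ENNReal.toReal_nonneg

/-! ### The coefficients of `Q_j` -/

lemma norm_chaosBasis_le_one (P : Measure TemperedDual) (γ : MultiIndex) :
    ‖chaosBasis P γ‖ ≤ 1 := by
  by_cases h : chaosBasis P γ = 0
  · rw [h, norm_zero]
    exact zero_le_one
  · exact (norm_chaosBasis P h).le

lemma coeff_coordElem (W : WeightPair) (P : Measure TemperedDual) (j : ℕ+) (γ : MultiIndex) :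
    MvPowerSeries.coeff γ (StrongAlg.series W (coordElem W P j)) =
      ⟪chaosBasis P γ, monomialLp P (Finsupp.single j 1)⟫_ℂ := rfl

/-- For `γ` before the index of `Q_j`, the basis vector lies in the closed span of monomials free of
the `j`-th variable, to which `Q_j` is orthogonal. For `γ` after it, Gram–Schmidt makes the basis
vector orthogonal to `Q_j`. -/
lemma IsMLMeasure.coeff_coordElem_of_ne {φ : ℂ → ℂ} {P : Measure TemperedDual}
    (hP : IsMLMeasure φ P) (W : WeightPair) {j : ℕ+} {γ : MultiIndex}
    (h : γ ≠ Finsupp.single j 1) :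
    MvPowerSeries.coeff γ (StrongAlg.series W (coordElem W P j)) = 0 := by
  rw [coeff_coordElem]
  rcases before_or_before h with hb | hb
  · refine Submodule.inner_right_of_mem_orthogonal (chaosBasis_mem P hb) ?_
    rw [prevSpan, Submodule.orthogonal_closure, Submodule.mem_orthogonal]
    intro u hu
    induction hu using Submodule.span_induction with
    | mem x hx =>
      obtain ⟨δ, ⟨k, hk, -⟩, rfl⟩ := hx
      refine hP.inner_monomialLp_single ?_
      rw [Finsupp.single_apply] at hk
      split_ifs at hk with hjk
      · rw [hjk]
        omega
      · omega
    | zero => exact inner_zero_left _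
    | add x y _ _ hx hy => rw [inner_add_left, hx, hy, add_zero]
    | smul c x _ hx => rw [inner_smul_left, hx, mul_zero]
  · have hr : residual P γ ∈ (prevSpan P γ)ᗮ := Submodule.sub_starProjection_mem_orthogonal _
    refine Submodule.inner_left_of_mem_orthogonal (K := prevSpan P γ) ?_
      (Submodule.smul_mem _ _ hr)
    exact Submodule.le_topologicalClosure _ (Submodule.subset_span ⟨_, hb, rfl⟩)

lemma IsMLMeasure.exists_norm_coeff_coordElem_le {φ : ℂ → ℂ} {P : Measure TemperedDual}
    (hP : IsMLMeasure φ P) (W : WeightPair) :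
    ∃ κ : ℝ, 0 ≤ κ ∧ ∀ (j : ℕ+) (γ : MultiIndex),
      ‖MvPowerSeries.coeff γ (StrongAlg.series W (coordElem W P j))‖ ≤ κ := by
  refine ⟨(eLpNorm (monomialFun (Finsupp.single 1 1)) 2 P).toReal, ENNReal.toReal_nonneg,
    fun j γ => ?_⟩
  rw [coeff_coordElem]
  calc _ ≤ ‖chaosBasis P γ‖ * ‖monomialLp P (Finsupp.single j 1)‖ := norm_inner_le_norm _ _
    _ ≤ 1 * ‖monomialLp P (Finsupp.single j 1)‖ :=
        mul_le_mul_of_nonneg_right (norm_chaosBasis_le_one P γ) (norm_nonneg _)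
    _ ≤ _ := by
        rw [one_mul]
        exact hP.norm_monomialLp_single_le j

/-! ### The process `N_φ` -/

lemma WeightPair.pow_le_a_pow (W : WeightPair) {A : ℝ} {m : ℕ} (hA : 0 ≤ A)
    (h : A ≤ W.a 1 ^ m) (j : ℕ+) : A ^ (j : ℕ) ≤ W.a j ^ m :=
  calc A ^ (j : ℕ) ≤ (W.a 1 ^ m) ^ (j : ℕ) := pow_le_pow_left₀ hA h _
    _ = (W.a 1 ^ (j : ℕ)) ^ m := by rw [← pow_mul, ← pow_mul, mul_comm]
    _ ≤ W.a j ^ m := pow_le_pow_left₀ (pow_pos (W.a_pos 1) _).le (W.a_one_pow_le j) m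

/-- Being a multiple of one monomial, `Q_j` can be placed in any `𝓗_p`, so the noise series can be
summed in norm there. -/
lemma IsMLMeasure.coordElem_eq_incl {φ : ℂ → ℂ} {P : Measure TemperedDual}
    (hP : IsMLMeasure φ P) (W : WeightPair) (p : ℕ) (j : ℕ+) :
    coordElem W P j = incl W p (Hp.mono W p (Finsupp.single j 1)
      (MvPowerSeries.coeff (Finsupp.single j 1) (StrongAlg.series W (coordElem W P j)))) := by
  classical
  refine StrongAlg.series_injective W (MvPowerSeries.ext fun γ => ?_)
  rw [series_incl, Hp.coeff_mono]
  split_ifs with h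
  · rw [h]
  · exact hP.coeff_coordElem_of_ne W h

/-- The series defining `N_φ(t)` converges unconditionally in `𝓐`. -/
lemma IsMLMeasure.summable_noise {φ : ℂ → ℂ} {P : Measure TemperedDual}
    (hP : IsMLMeasure φ P) (W : WeightPair) (t : ℝ) :
    Summable fun j : ℕ+ => ((hermiteFun j t : ℝ) : ℂ) • coordElem W P j := by
  obtain ⟨κ, hκ0, hκ⟩ := hP.exists_norm_coeff_coordElem_le W
  set A : ℝ := 1 + √2 * |t| with hA
  have hA0 : 0 ≤ A := by positivity
  -- `A ^ j` bounds `|ζ_j(t)|`; the extra factor `2` leaves `2 ^ (-j)`, giving absolute convergence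
  -- in `𝓗_{2m}`.
  obtain ⟨m, hm⟩ := W.exists_le_a_one_pow (2 * A)
  set c : ℕ+ → ℂ := fun j =>
    MvPowerSeries.coeff (Finsupp.single j 1) (StrongAlg.series W (coordElem W P j)) with hc
  have hterm : ∀ j : ℕ+, ((hermiteFun j t : ℝ) : ℂ) • coordElem W P j =
      incl W (2 * m) (((hermiteFun j t : ℝ) : ℂ) • Hp.mono W (2 * m) (Finsupp.single j 1) (c j)) :=
    fun j => by rw [map_smul, ← hP.coordElem_eq_incl]
  simp only [hterm]
  have hgeom : Summable fun j : ℕ+ => (1 / 2 : ℝ) ^ (j : ℕ) :=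
    (summable_geometric_of_lt_one (by norm_num) (by norm_num)).comp_injective PNat.coe_injective
  have hs : Summable fun j : ℕ+ =>
      ((hermiteFun j t : ℝ) : ℂ) • Hp.mono W (2 * m) (Finsupp.single j 1) (c j) := by
    refine Summable.of_norm_bounded (hgeom.mul_left ((W.b 1 ^ m)⁻¹ * κ)) fun j => ?_
    have hb := pow_pos (W.b_pos 1) m
    have ha := pow_pos (W.a_pos j) m
    have h1 := W.pow_le_a_pow (by positivity) hm j
    have h2 := abs_hermiteFun_le j t
    rw [norm_smul, Hp.norm_mono, W.scale_two_mul, W.weight_single, Complex.norm_real,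
      Real.norm_eq_abs, mul_pow, mul_inv]
    calc |hermiteFun j t| * ((W.b 1 ^ m)⁻¹ * (W.a j ^ m)⁻¹ * ‖c j‖)
        ≤ A ^ (j : ℕ) * ((W.b 1 ^ m)⁻¹ * (W.a j ^ m)⁻¹ * κ) := by
          gcongr
          exact hκ j _
      _ = (W.b 1 ^ m)⁻¹ * κ * (A ^ (j : ℕ) * (W.a j ^ m)⁻¹) := by ring
      _ ≤ (W.b 1 ^ m)⁻¹ * κ * (1 / 2 : ℝ) ^ (j : ℕ) := by
          gcongr
          rw [← div_eq_mul_inv, div_le_iff₀ ha]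
          calc A ^ (j : ℕ) = (1 / 2) ^ (j : ℕ) * (2 * A) ^ (j : ℕ) := by
                rw [← mul_pow]
                congr 1
                ring
            _ ≤ _ := by gcongr
  exact hs.map (incl W (2 * m)) (continuous_incl W (2 * m))

lemma IsMLMeasure.coeff_noise {φ : ℂ → ℂ} {P : Measure TemperedDual}
    (hP : IsMLMeasure φ P) (W : WeightPair) (t : ℝ) (γ : MultiIndex) :
    MvPowerSeries.coeff γ (StrongAlg.series W (noise W φ P t)) =
      (((√(coeffOne φ))⁻¹ : ℝ) : ℂ) * ∑' j : ℕ+, ((hermiteFun j t : ℝ) : ℂ) *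
        MvPowerSeries.coeff γ (StrongAlg.series W (coordElem W P j)) := by
  rw [← StrongAlg.coeffCLM_apply, noise, map_smul,
    (StrongAlg.coeffCLM W γ).map_tsum (hP.summable_noise W t), smul_eq_mul]
  simp only [map_smul, smul_eq_mul, StrongAlg.coeffCLM_apply]

lemma IsMLMeasure.coeff_noise_single {φ : ℂ → ℂ} {P : Measure TemperedDual}
    (hP : IsMLMeasure φ P) (W : WeightPair) (t : ℝ) (j : ℕ+) :
    MvPowerSeries.coeff (Finsupp.single j 1) (StrongAlg.series W (noise W φ P t)) =
      (((√(coeffOne φ))⁻¹ : ℝ) : ℂ) * (((hermiteFun j t : ℝ) : ℂ) *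
        MvPowerSeries.coeff (Finsupp.single j 1) (StrongAlg.series W (coordElem W P j))) := by
  rw [hP.coeff_noise, tsum_eq_single j fun i hi => ?_]
  rw [hP.coeff_coordElem_of_ne W, mul_zero]
  intro h
  exact hi (Finsupp.single_left_injective one_ne_zero h).symm

lemma IsMLMeasure.coeff_noise_of_ne {φ : ℂ → ℂ} {P : Measure TemperedDual}
    (hP : IsMLMeasure φ P) (W : WeightPair) (t : ℝ) {γ : MultiIndex}
    (h : ∀ j, γ ≠ Finsupp.single j 1) :
    MvPowerSeries.coeff γ (StrongAlg.series W (noise W φ P t)) = 0 := by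
  rw [hP.coeff_noise]
  simp only [hP.coeff_coordElem_of_ne W (h _), mul_zero, tsum_zero]

lemma IsMLMeasure.continuous_coeff_noise {φ : ℂ → ℂ} {P : Measure TemperedDual}
    (hP : IsMLMeasure φ P) (W : WeightPair) (γ : MultiIndex) :
    Continuous fun t => MvPowerSeries.coeff γ (StrongAlg.series W (noise W φ P t)) := by
  by_cases h : ∃ j, γ = Finsupp.single j 1
  · obtain ⟨j, rfl⟩ := h
    simp only [hP.coeff_noise_single]
    have := continuous_hermiteFun j
    fun_prop
  · push Not at h
    simp only [hP.coeff_noise_of_ne W _ h]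
    exact continuous_const

/-- Each coefficient involves at most one `ζ_j`, so no summation over `j` is needed and the exponent
depends on `R` only, not on `t`. -/
lemma IsMLMeasure.exists_norm_coeff_noise_le {φ : ℂ → ℂ} {P : Measure TemperedDual}
    (hP : IsMLMeasure φ P) (W : WeightPair) (R : ℝ) :
    ∃ (C : ℝ) (k : ℕ), 0 ≤ C ∧ ∀ t, |t| ≤ R → ∀ γ,
      ‖MvPowerSeries.coeff γ (StrongAlg.series W (noise W φ P t))‖ ≤ C * W.weight γ ^ k := by
  obtain ⟨κ, hκ0, hκ⟩ := hP.exists_norm_coeff_coordElem_le W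
  obtain ⟨m, hm⟩ := W.exists_le_a_one_pow (1 + √2 * R)
  have hb := pow_pos (W.b_pos 1) m
  have hc : 0 ≤ (√(coeffOne φ))⁻¹ := inv_nonneg.mpr (Real.sqrt_nonneg _)
  refine ⟨(√(coeffOne φ))⁻¹ * κ * (W.b 1 ^ m)⁻¹, m, by positivity, fun t ht γ => ?_⟩
  have hw := pow_pos (W.weight_pos γ) m
  by_cases h : ∃ j, γ = Finsupp.single j 1
  · obtain ⟨j, rfl⟩ := h
    have h1 : |hermiteFun j t| ≤ W.a j ^ m := by
      refine (abs_hermiteFun_le j t).trans (W.pow_le_a_pow (by positivity) ?_ j)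
      refine le_trans ?_ hm
      gcongr
    rw [hP.coeff_noise_single, norm_mul, norm_mul, Complex.norm_real, Complex.norm_real,
      Real.norm_of_nonneg hc, Real.norm_eq_abs, W.weight_single, mul_pow]
    calc _ ≤ (√(coeffOne φ))⁻¹ * (W.a j ^ m * κ) := by
          have := pow_pos (W.a_pos j) m
          gcongr
          exact hκ j _
      _ = _ := by field_simp
  · push Not at h
    rw [hP.coeff_noise_of_ne W t h, norm_zero]
    positivity

/-! ### Coefficient bounds for Wick products -/

/-- A product of two series whose coefficients are bounded by a power of the weight has
coefficients bounded by a power of the weight. -/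
lemma WeightPair.exists_norm_coeff_mul_le (W : WeightPair) {C D : ℝ} (hC : 0 ≤ C) (hD : 0 ≤ D)
    (k l : ℕ) : ∃ (B : ℝ) (n : ℕ), ∀ f g : Series,
      (∀ α, ‖MvPowerSeries.coeff α f‖ ≤ C * W.weight α ^ k) →
      (∀ α, ‖MvPowerSeries.coeff α g‖ ≤ D * W.weight α ^ l) →
      ∀ γ, ‖MvPowerSeries.coeff γ (f * g)‖ ≤ B * W.weight γ ^ n := by
  classical
  obtain ⟨E, hE, hEk⟩ := W.exists_pow_weight_le (le_max_left k l)
  obtain ⟨E', hE', hEl⟩ := W.exists_pow_weight_le (le_max_right k l)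
  obtain ⟨A, m, hA, hcard⟩ := W.exists_card_antidiagonal_le
  refine ⟨A * (C * E * (D * E')), m + max k l, fun f g hf hg γ => ?_⟩
  rw [MvPowerSeries.coeff_mul]
  -- At the common exponent `max k l`, supermultiplicativity bounds every term by the same power of
  -- the weight of `γ`.
  have hterm : ∀ p ∈ Finset.HasAntidiagonal.antidiagonal γ,
      ‖MvPowerSeries.coeff p.1 f * MvPowerSeries.coeff p.2 g‖ ≤
        C * E * (D * E') * W.weight γ ^ max k l := by
    intro p hp
    rw [Finset.HasAntidiagonal.mem_antidiagonal] at hp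
    have h1 := W.weight_pos p.1
    have h2 := W.weight_pos p.2
    have h3 := W.weight_mul_le p.1 p.2
    rw [hp] at h3
    calc _ = ‖MvPowerSeries.coeff p.1 f‖ * ‖MvPowerSeries.coeff p.2 g‖ := norm_mul _ _
      _ ≤ (C * (E * W.weight p.1 ^ max k l)) * (D * (E' * W.weight p.2 ^ max k l)) :=
          mul_le_mul ((hf _).trans (mul_le_mul_of_nonneg_left (hEk _) hC))
            ((hg _).trans (mul_le_mul_of_nonneg_left (hEl _) hD)) (norm_nonneg _) (by positivity)
      _ = C * E * (D * E') * (W.weight p.1 * W.weight p.2) ^ max k l := by ring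
      _ ≤ C * E * (D * E') * W.weight γ ^ max k l := by gcongr
  refine (norm_sum_le_of_le _ hterm).trans ?_
  have hw := W.weight_pos γ
  rw [Finset.sum_const, nsmul_eq_mul]
  calc _ ≤ A * W.weight γ ^ m * (C * E * (D * E') * W.weight γ ^ max k l) :=
        mul_le_mul_of_nonneg_right (hcard γ) (by positivity)
    _ = _ := by ring

end

end ChaosML

/-! ### The stochastic integral -/

theorem mainTheorem8 (W : ChaosML.WeightPair) (φ : ℂ → ℂ) (hφ : ChaosML.IsML φ)
    (P : MeasureTheory.Measure ChaosML.TemperedDual) (hP : ChaosML.IsMLMeasure φ P)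
    (f : ℝ → ChaosML.StrongAlg W) (hf : ContinuousOn f (Set.Icc 0 1)) :
    (∀ t : ℝ, Summable fun j : ℕ+ =>
      ((ChaosML.hermiteFun j t : ℝ) : ℂ) • ChaosML.coordElem W P j) ∧
    ∃ (h : ℝ → ChaosML.StrongAlg W) (I : ChaosML.StrongAlg W),
      (∀ t ∈ Set.Icc (0 : ℝ) 1,
        ChaosML.StrongAlg.series W (h t) = ChaosML.wick W (f t) (ChaosML.noise W φ P t)) ∧
      ChaosML.HasRiemannIntegral h 0 1 I ∧
      (∀ I' : ChaosML.StrongAlg W, ChaosML.HasRiemannIntegral h 0 1 I' → I' = I) ∧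
      ∃ p₀ : ℕ, 1 ≤ p₀ ∧ ∃ (g : ℝ → ChaosML.Hp W p₀) (J : ChaosML.Hp W p₀),
        (∀ t ∈ Set.Icc (0 : ℝ) 1, ChaosML.incl W p₀ (g t) = h t) ∧
        ChaosML.HasRiemannIntegral g 0 1 J ∧
        ChaosML.incl W p₀ J = I := by
  classical
  refine ⟨hP.summable_noise W, ?_⟩
  obtain ⟨C, k, hC, hfC⟩ :=
    ChaosML.exists_norm_coeff_le_of_isCompact W (isCompact_Icc.image_of_continuousOn hf)
  obtain ⟨D, l, hD, hnD⟩ := hP.exists_norm_coeff_noise_le W 1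
  obtain ⟨B, n, hB⟩ := W.exists_norm_coeff_mul_le hC hD k l
  obtain ⟨p, hp, G, hG, hGs⟩ := ChaosML.exists_continuousOn_hp W (s := Set.Icc (0 : ℝ) 1)
    (fun t => ChaosML.wick W (f t) (ChaosML.noise W φ P t)) B n
    -- Each coefficient of the product is a finite sum of products of continuous coefficients.
    (fun γ => by
      simp only [ChaosML.wick, MvPowerSeries.coeff_mul]
      refine continuousOn_finsetSum _ fun q _ => ContinuousOn.mul ?_ ?_
      · exact (ChaosML.StrongAlg.coeffCLM W q.1).continuous.comp_continuousOn hf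
      · exact (hP.continuous_coeff_noise W q.2).continuousOn)
    (fun t ht => hB _ _ (hfC _ ⟨t, ht, rfl⟩)
      (hnD t (abs_le.mpr ⟨by linarith [ht.1], ht.2⟩)))
  -- The integral is formed in the Hilbert space `𝓗_p`, where completeness is available, and only
  -- then mapped to `𝓐`.
  have hJ := ChaosML.hasRiemannIntegral_intervalIntegral zero_le_one hG
  have hI := hJ.map ((ChaosML.incl W p).restrictScalars ℝ) (ChaosML.continuous_incl W p)
  exact ⟨fun t => ChaosML.incl W p (G t), _, fun t ht => hGs t ht, hI,
    fun I' hI' => hI'.unique zero_le_one hI, p, hp, G, _, fun _ _ => rfl, hJ, rfl⟩
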